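/- Let $p$ be a prime, $k$ a field of characteristic $p$, $n\ge 2$, and $R=k[[x_1,\dots,x_n]]$ with maximal ideal $\mathfrak m_R$. Let $a_1,\dots,a_n\in\mathfrak m_R$ be pairwise coprime (no common non-unit factor in $R$), and let $\mu\in R\setminus\{0\}$ be coprime to every $a_i$. Put $$A=R[u_1,\dots,u_n]/\bigl(u_i^p-(\mu a_i)^{p-1}u_i-x_i,\ i=1,\dots,n\bigr).$$ Then $A$ is a domain, and $\operatorname{Frac}(A)/\operatorname{Frac}(R)$ is a Galois extension whose Galois group $H$ is identified with $(\mathbb Z/p)^n$, the element $(\nu_1,\dots,\nu_n)$ corresponding to the automorphism with $u_j\mapsto u_j+\nu_j\mu a_j$ for all $j$. The subgroups of $H$ of order $p^{n-1}$ are exactly the groups $H_s=\{\nu\mid \sum_i \nu_i s_i=0\}$ for $s\in(\mathbb Z/p)^n$, $s\neq 0$. For $s\ne0$ put $\alpha=\prod_{s_i\neq 0}a_i$, $\alpha_i=\alpha/a_i$ (for $s_i\ne0$), $z_s=\sum_{s_i\neq0}s_i\alpha_iu_i\in A$, and $$f(z)=z^p-(\mu\alpha)^{p-1}z-\sum_{s_i\neq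 0}s_i\alpha_i^p x_i\in R[z].$$ Then, for every $s\neq0$: 1. there is an isomorphism of $R$-algebras $R[z]/(f(z))\cong A^{H_s}$ that sends the class of $z$ to $z_s$; 2. in particular, $A^{H_s}$ is flat over $R$; 3. the action of $H$ induces an action of $H/H_s$ on $A^{H_s}$ by $R$-algebra automorphisms, through pseudo-reflections: $A^{H_s}$ is a noetherian local ring and, for each non-trivial $\sigma\in H/H_s$, $\sigma$ has finite order on $A^{H_s}$ and the ideal of $A^{H_s}$ generated by all $\sigma(b)-b$, $b\in A^{H_s}$, is generated by one regular non-unit. -/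

import Mathlib

noncomputable section

namespace ArtinSchreierTower

/-- The ring `A = R[u_1, …, u_n] / (u_i ^ p - (μ a_i) ^ (p - 1) u_i - x_i)` over
`R = k[[x_1, …, x_n]]`. -/
def Tower {k : Type*} [Field k] {n : ℕ} (p : ℕ)
    (a : Fin n → MvPowerSeries (Fin n) k) (μ : MvPowerSeries (Fin n) k) : Type _ :=
  MvPolynomial (Fin n) (MvPowerSeries (Fin n) k) ⧸
    Ideal.span (Set.range fun i : Fin n =>
      (MvPolynomial.X i ^ p - MvPolynomial.C ((μ * a i) ^ (p - 1)) * MvPolynomial.X i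
        - MvPolynomial.C (MvPowerSeries.X i) :
          MvPolynomial (Fin n) (MvPowerSeries (Fin n) k)))

instance {k : Type*} [Field k] {n : ℕ} (p : ℕ)
    (a : Fin n → MvPowerSeries (Fin n) k) (μ : MvPowerSeries (Fin n) k) :
    CommRing (Tower p a μ) :=
  Ideal.Quotient.commRing _

instance {k : Type*} [Field k] {n : ℕ} (p : ℕ)
    (a : Fin n → MvPowerSeries (Fin n) k) (μ : MvPowerSeries (Fin n) k) :
    Algebra (MvPowerSeries (Fin n) k) (Tower p a μ) :=
  Ideal.Quotient.algebra _

/-- The class `u_i` in `A` of the `i`-th variable. -/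
def u {k : Type*} [Field k] {n : ℕ} (p : ℕ)
    (a : Fin n → MvPowerSeries (Fin n) k) (μ : MvPowerSeries (Fin n) k) (i : Fin n) :
    Tower p a μ :=
  Ideal.Quotient.mk _ (MvPolynomial.X i)

/-- The support `{i | s_i ≠ 0}` of a vector `s`. -/
def supp {p n : ℕ} (s : Fin n → ZMod p) : Finset (Fin n) :=
  Finset.univ.filter fun i => s i ≠ 0

/-- The product `α` of the `a_i` with `s_i ≠ 0`. -/
def alpha {k : Type*} [Field k] {p n : ℕ}
    (a : Fin n → MvPowerSeries (Fin n) k) (s : Fin n → ZMod p) : MvPowerSeries (Fin n) k :=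
  ∏ j ∈ supp s, a j

/-- The quotient `α_i = α / a_i` (used when `s_i ≠ 0`), as the product of the `a_j` with
`s_j ≠ 0` and `j ≠ i`. -/
def alphaDiv {k : Type*} [Field k] {p n : ℕ}
    (a : Fin n → MvPowerSeries (Fin n) k) (s : Fin n → ZMod p) (i : Fin n) :
    MvPowerSeries (Fin n) k :=
  ∏ j ∈ (supp s).erase i, a j

/-- The polynomial `f(z) = z ^ p - (μ α) ^ (p - 1) z - ∑_{s_i ≠ 0} s_i α_i ^ p x_i` in `R[z]`. -/
def f {k : Type*} [Field k] {p n : ℕ}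
    (a : Fin n → MvPowerSeries (Fin n) k) (μ : MvPowerSeries (Fin n) k)
    (s : Fin n → ZMod p) : Polynomial (MvPowerSeries (Fin n) k) :=
  Polynomial.X ^ p - Polynomial.C ((μ * alpha a s) ^ (p - 1)) * Polynomial.X
    - Polynomial.C (∑ i ∈ supp s,
        ((s i).cast : MvPowerSeries (Fin n) k) * alphaDiv a s i ^ p * MvPowerSeries.X i)

/-- The element `z_s = α ∑ s_i u_i / a_i = ∑_{s_i ≠ 0} s_i α_i u_i` of `A`. -/
def z {k : Type*} [Field k] {p n : ℕ}
    (a : Fin n → MvPowerSeries (Fin n) k) (μ : MvPowerSeries (Fin n) k)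
    (s : Fin n → ZMod p) : Tower p a μ :=
  ∑ i ∈ supp s,
    algebraMap (MvPowerSeries (Fin n) k) (Tower p a μ)
      (((s i).cast : MvPowerSeries (Fin n) k) * alphaDiv a s i) * u p a μ i

/-- The subgroup `{ν | ∑ ν_i s_i = 0}` of `(ℤ/p)^n` (written multiplicatively). -/
def perp {p n : ℕ} (s : Fin n → ZMod p) : Subgroup (Multiplicative (Fin n → ZMod p)) where
  carrier := {ν | ∑ i, Multiplicative.toAdd ν i * s i = 0}
  one_mem' := by simp
  mul_mem' := by
    intro x y hx hy
    simp only [Set.mem_ofPred_eq] at hx hy ⊢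
    simp [toAdd_mul, add_mul, Finset.sum_add_distrib, hx, hy]
  inv_mem' := by
    intro x hx
    simp only [Set.mem_ofPred_eq] at hx ⊢
    simp [toAdd_inv, hx]

/-- The ring of invariants `A^G = A ∩ L^G` of a group `G` of automorphisms of the fraction field
`L` of `A` that fix the fraction field `K` of `R`, as an `R`-subalgebra of `A`. -/
def invariants (R A : Type*) {K L : Type*} [CommRing R] [CommRing A] [Algebra R A]
    [Field K] [Field L] [Algebra R K] [Algebra A L] [Algebra K L] [Algebra R L]
    [IsScalarTower R K L] [IsScalarTower R A L] (G : Subgroup (L ≃ₐ[K] L)) :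
    Subalgebra R A where
  carrier := {b | ∀ h ∈ G, h (algebraMap A L b) = algebraMap A L b}
  mul_mem' := by
    intro x y hx hy h hh
    rw [map_mul, map_mul, hx h hh, hy h hh]
  add_mem' := by
    intro x y hx hy h hh
    rw [map_add, map_add, hx h hh, hy h hh]
  algebraMap_mem' := by
    intro r h _
    rw [← IsScalarTower.algebraMap_apply R A L, IsScalarTower.algebraMap_apply R K L, h.commutes]

/-- The ideal of the fixed scheme of an automorphism `σ`, generated by all `σ b - b`. -/
def fixedIdeal {B : Type*} [CommRing B] (σ : B ≃+* B) : Ideal B :=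
  Ideal.span (Set.range fun b => σ b - b)

/-- A pseudo-reflection of a noetherian local ring `B`: an automorphism of finite order whose
fixed scheme has an ideal generated by one regular non-unit. -/
structure IsPseudoReflection {B : Type*} [CommRing B] (σ : B ≃+* B) : Prop where
  isNoetherianRing : IsNoetherianRing B
  isLocalRing : IsLocalRing B
  isOfFinOrder : IsOfFinOrder σ
  exists_generator : ∃ x ∈ nonZeroDivisors B, ¬ IsUnit x ∧ fixedIdeal σ = Ideal.span {x}

end ArtinSchreierTower

end

/-! The elements `w_i = u_i / (μ a_i)` satisfy `w_i ^ p - w_i = x_i / (μ a_i) ^ p`, so `Frac(A) /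
Frac(R)` is an Artin–Schreier extension. By duality over `𝔽_p`, every translation `w_i ↦ w_i + ν_i`
comes from the Galois group once no combination `∑ s_i x_i / (μ a_i) ^ p` with `s ≠ 0` has the form
`y ^ p - y` with `y ∈ Frac(R)`. Since `R` is factorial (Weierstrass preparation), hence integrally
closed, such a `y` would give, after multiplication by `μ α`, a root of `f` in `R`. Comparing orders
excludes this: `μ α` has larger order than each `α_i` (`f_no_root`, `pow_sub_ne_sum`).

Every element of `A` is a polynomial in the `u_i` of degree less than `p` in each variable.
Translations give `p` values per coordinate, so such a polynomial is determined by its values on the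
grid of translates (`eq_C_of_eval_translate_eq`). Hence `A` embeds in the separable closure of
`Frac(R)` and is a domain.

Translation by `ν` adds `(∑ ν_i s_i) μ α` to `z_s`, so `z_s` is `H_s`-invariant. Conversely, for `i`
in the support of `s`, a power of `α_i` allows `u_i` to be eliminated in favour of `z_s`, while
`H_s` still translates the other `u_j` freely; the grid argument gives `α_i ^ N y ∈ R[z_s]` for each
invariant `y`. The `a_i` being pairwise coprime, these powers have no common prime factor, and
comparing coefficients yields `y ∈ R[z_s]` (`mem_adjoin_z`). Finally `f ≡ z ^ p` modulo the maximal
ideal, so `R[z]/(f)` is local, and `σ z_s - z_s` is a unit times `μ α`. -/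

/-! ### Weierstrass preparation and unique factorization in `k[[x_1, …, x_n]]`. -/

section
-- Weierstrass preparation gives `g = w h` with `w` distinguished and `h` a unit, and `A[[X]]/(g) ≅
-- A[X]/(w)`. Irreducibility passes from `g` to `w`, and `A[X]` is factorial, so `w` is prime.
open PowerSeries in
theorem PowerSeries.prime_of_irreducible_of_map_residue_ne_zero {A : Type*} [CommRing A] [IsDomain A]
    [IsLocalRing A] [UniqueFactorizationMonoid A] [IsAdicComplete (IsLocalRing.maximalIdeal A) A]
    {g : PowerSeries A} (hg : Irreducible g) (h0 : g.map (IsLocalRing.residue A) ≠ 0) :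
    Prime g := by
  obtain ⟨w, h, H⟩ := g.exists_isWeierstrassFactorization h0
  obtain ⟨hw, hh, hgw⟩ := H
  -- A monic factor of `w` reduces to a power of `X`; if it is a unit as a power series, its
  -- constant term is a unit and that power is `X ^ 0`.
  have key : ∀ a b : Polynomial A, a.Monic → a * b = w → IsUnit (a : PowerSeries A) →
      a.natDegree = 0 := by
    intro a b ha hab hu
    have h1 := hw.map_eq_X_pow
    have h2 : (a.map (Ideal.Quotient.mk (IsLocalRing.maximalIdeal A))).Monic := ha.map _
    have h3 : a.map (Ideal.Quotient.mk (IsLocalRing.maximalIdeal A)) ∣ Polynomial.X ^ w.natDegree := by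
      rw [← h1, ← hab, Polynomial.map_mul]; exact dvd_mul_right _ _
    let _ : Field (A ⧸ IsLocalRing.maximalIdeal A) := Ideal.Quotient.field _
    obtain ⟨i, -, hi⟩ := (dvd_prime_pow Polynomial.prime_X _).1 h3
    have h4 := Polynomial.eq_of_monic_of_associated h2 (Polynomial.monic_X_pow i) hi
    have h5 : IsUnit (a.coeff 0) := by
      have := hu.map (PowerSeries.constantCoeff (R := A))
      simpa using this
    have h6 := congrArg (fun q => Polynomial.coeff q 0) h4
    simp only [Polynomial.coeff_map, Polynomial.coeff_X_pow] at h6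
    have h7 : Ideal.Quotient.mk (IsLocalRing.maximalIdeal A) (a.coeff 0) ≠ 0 := (h5.map _).ne_zero
    have h8 : i = 0 := by
      by_contra hi0
      rw [if_neg (Ne.symm hi0)] at h6
      exact h7 h6
    rw [h8] at h4
    rw [← ha.natDegree_map (Ideal.Quotient.mk (IsLocalRing.maximalIdeal A)), h4]
    simp
  have hirr : Irreducible w := by
    rw [hw.monic.irreducible_iff_natDegree]
    refine ⟨?_, ?_⟩
    · rintro rfl
      exact hg.not_isUnit (by rw [hgw]; simpa using hh)
    · intro a b ha hb hab
      have : g = (a : PowerSeries A) * (b * h) := by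
        rw [hgw, ← hab, Polynomial.coe_mul, mul_assoc]
      rcases hg.isUnit_or_isUnit this with hu | hu
      · exact Or.inl (key a b ha hab hu)
      · exact Or.inr (key b a hb (by rw [mul_comm, hab]) (isUnit_of_mul_isUnit_left hu))
  have hp : (Ideal.span {w}).IsPrime :=
    (Ideal.span_singleton_prime hirr.ne_zero).2 hirr.prime
  rw [← Ideal.span_singleton_prime hg.ne_zero, ← Ideal.Quotient.isDomain_iff_prime]
  have := (Ideal.Quotient.isDomain_iff_prime _).2 hp
  exact (PowerSeries.IsWeierstrassFactorizationAt.algEquivQuotient ⟨hw, hh, hgw⟩).symm.toMulEquiv.isDomain _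

/-- Take `e` lexicographically minimal, the highest index being compared first, and weights in a
base exceeding the sum of the entries of `e`: an excess of one at index `i` outweighs everything `e`
has below `i`. -/
theorem exists_weight_unique_min {m : ℕ} (S : Set (Fin m →₀ ℕ)) (hS : S.Nonempty) :
    ∃ B : ℕ, B ≠ 0 ∧ ∃ e ∈ S, ∀ d ∈ S, ∑ i : Fin m, B ^ (i : ℕ) * d i = ∑ i : Fin m, B ^ (i : ℕ) * e i → d = e := by
  have hwf : WellFounded (Pi.Lex (ι := Fin m) (β := fun _ => ℕ) (· > ·) (fun {_} => (· < ·))) :=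
    Pi.Lex.wellFounded _ (fun _ => wellFounded_lt)
  obtain ⟨e', ⟨e, he, rfl⟩, hmin⟩ := hwf.has_min ((fun d : Fin m →₀ ℕ => (d : Fin m → ℕ)) '' S) (hS.image _)
  refine ⟨1 + ∑ i, e i, by omega, e, he, fun d hd hw => ?_⟩
  by_contra hne
  set B := 1 + ∑ i, e i with hB
  have hne' : (Finset.univ.filter fun i => d i ≠ e i).Nonempty := by
    by_contra h
    rw [Finset.not_nonempty_iff_eq_empty, Finset.filter_eq_empty_iff] at h
    exact hne (Finsupp.ext fun i => by simpa using h (Finset.mem_univ i))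
  set i := (Finset.univ.filter fun i => d i ≠ e i).max' hne' with hi
  have hi1 : d i ≠ e i := (Finset.mem_filter.1 (Finset.max'_mem _ hne')).2
  have hi2 : ∀ j, i < j → d j = e j := by
    intro j hj
    by_contra h
    exact absurd (Finset.le_max' _ j (Finset.mem_filter.2 ⟨Finset.mem_univ _, h⟩)) (not_le.2 hj)
  have hlt : e i < d i := by
    refine lt_of_le_of_ne (not_lt.1 fun h => hmin _ ⟨d, hd, rfl⟩ ⟨i, fun j hj => hi2 j hj, h⟩) hi1.symm
  have split : ∀ q : Fin m → ℕ, ∑ j, q j = (∑ j with j < i, q j) + q i + ∑ j with i < j, q j := by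
    intro q
    rw [← Finset.sum_filter_add_sum_filter_not Finset.univ (fun j => j < i), add_assoc]
    congr 1
    have : (Finset.univ.filter fun j => ¬ j < i) = insert i (Finset.univ.filter fun j => i < j) := by
      ext j; simp [le_iff_eq_or_lt, eq_comm]
    rw [this, Finset.sum_insert (by simp)]
  rw [split, split] at hw
  have h1 : ∑ j with i < j, B ^ (j : ℕ) * d j = ∑ j with i < j, B ^ (j : ℕ) * e j :=
    Finset.sum_congr rfl fun j hj => by rw [hi2 j (Finset.mem_filter.1 hj).2]
  have hBpos : 0 < B := by omega
  have h2 : ∑ j with j < i, B ^ (j : ℕ) * e j < B ^ (i : ℕ) := by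
    rcases Nat.eq_zero_or_pos (i : ℕ) with h0 | h0
    · rw [Finset.filter_false_of_mem]
      · simp [hBpos]
      · intro j _ hj
        have : (j : ℕ) < i := hj
        omega
    · calc ∑ j with j < i, B ^ (j : ℕ) * e j ≤ ∑ j with j < i, B ^ (i - 1 : ℕ) * e j := by
            refine Finset.sum_le_sum fun j hj => Nat.mul_le_mul_right _ (Nat.pow_le_pow_right hBpos ?_)
            have : (j : ℕ) < i := (Finset.mem_filter.1 hj).2
            omega
        _ ≤ B ^ (i - 1 : ℕ) * ∑ j, e j := by
            rw [← Finset.mul_sum]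
            exact Nat.mul_le_mul_left _ (Finset.sum_le_univ_sum_of_nonneg (by simp))
        _ < B ^ (i - 1 : ℕ) * B := Nat.mul_lt_mul_of_pos_left (by omega) (pow_pos hBpos _)
        _ = B ^ (i : ℕ) := by rw [← pow_succ]; congr 1; omega
  have h3 : B ^ (i : ℕ) * (e i + 1) ≤ B ^ (i : ℕ) * d i := Nat.mul_le_mul_left _ hlt
  rw [mul_add, mul_one] at h3
  omega

namespace MvPowerSeries
variable {k : Type*} [Field k]

theorem shear_hasSubst {n : ℕ} (c : Fin n → MvPowerSeries (Fin (n + 1)) k)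
    (hc : ∀ j, constantCoeff (c j) = 0) :
    HasSubst (Fin.cons (X 0) fun j => X j.succ + c j : Fin (n + 1) → MvPowerSeries (Fin (n + 1)) k) := by
  refine hasSubst_of_constantCoeff_zero fun i => ?_
  refine Fin.cases ?_ (fun j => ?_) i <;> simp [hc]

theorem shear_shear {n : ℕ} (N : Fin n → ℕ) (hN : ∀ j, N j ≠ 0) (ε : k)
    (f : MvPowerSeries (Fin (n + 1)) k) :
    subst (Fin.cons (X 0) fun j => X j.succ + C (-ε) * X 0 ^ N j : Fin (n + 1) → MvPowerSeries (Fin (n + 1)) k)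
      (subst (Fin.cons (X 0) fun j => X j.succ + C ε * X 0 ^ N j : Fin (n + 1) → MvPowerSeries (Fin (n + 1)) k) f)
      = f := by
  have h1 := shear_hasSubst (fun j => C ε * (X 0 : MvPowerSeries (Fin (n + 1)) k) ^ N j) (by simp [hN])
  have h2 := shear_hasSubst (fun j => C (-ε) * (X 0 : MvPowerSeries (Fin (n + 1)) k) ^ N j) (by simp [hN])
  rw [subst_comp_subst_apply h1 h2]
  conv_rhs => rw [← id_eq f, ← subst_self]
  congr 1
  funext i
  refine Fin.cases ?_ (fun j => ?_) i
  · simp only [Fin.cons_zero]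
    rw [subst_X h2, Fin.cons_zero]
  · have hC : subst (Fin.cons (X 0) fun j => X j.succ + C (-ε) * X 0 ^ N j :
        Fin (n + 1) → MvPowerSeries (Fin (n + 1)) k) (C ε : MvPowerSeries (Fin (n + 1)) k) = C ε :=
      subst_C ε
    simp only [Fin.cons_succ]
    rw [subst_add h2, subst_mul h2, subst_pow h2, subst_X h2, subst_X h2, hC]
    simp

/-- A change of variables makes `f` regular in `X_0`, as Weierstrass preparation requires. Under
`X_j ↦ X_j + X_0 ^ (B ^ j)` for `j > 0`, restricted to the `X_0`-axis, a monomial becomes `X_0` to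
its weight, so the exponent with a unique weight cannot cancel. -/
theorem exists_algEquiv_map_residue_ne_zero {n : ℕ} {f : MvPowerSeries (Fin (n + 1)) k} (hf : f ≠ 0) :
    ∃ φ : MvPowerSeries (Fin (n + 1)) k ≃ₐ[k] MvPowerSeries (Fin (n + 1)) k,
      (finSuccEquiv k n (φ f)).map (IsLocalRing.residue (MvPowerSeries (Fin n) k)) ≠ 0 := by
  obtain ⟨e₀, he₀⟩ : ∃ e, coeff e f ≠ 0 := by
    by_contra! h
    exact hf (MvPowerSeries.ext h)
  obtain ⟨B, hB, e, he, huniq⟩ := exists_weight_unique_min {e | coeff e f ≠ 0} ⟨e₀, he₀⟩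
  set N : Fin n → ℕ := fun j => B ^ (j.succ : ℕ) with hNdef
  have hN : ∀ j, N j ≠ 0 := fun j => pow_ne_zero _ hB
  have h1 := shear_hasSubst (fun j => C (1 : k) * (X 0 : MvPowerSeries (Fin (n + 1)) k) ^ N j) (by simp [hN])
  have h2 := shear_hasSubst (fun j => C (-1 : k) * (X 0 : MvPowerSeries (Fin (n + 1)) k) ^ N j) (by simp [hN])
  refine ⟨AlgEquiv.ofAlgHom (substAlgHom h1) (substAlgHom h2) ?_ ?_, ?_⟩
  · ext1 g
    have := shear_shear N hN (-1 : k) g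
    rw [neg_neg] at this
    simpa [coe_substAlgHom] using this
  · ext1 g
    simpa [coe_substAlgHom] using shear_shear N hN (1 : k) g
  intro h0
  set W := ∑ i : Fin (n + 1), B ^ (i : ℕ) * e i
  -- Restriction to the `X_0`-axis.
  set θ : MvPowerSeries (Fin (n + 1)) k →+* PowerSeries k :=
    (PowerSeries.map (constantCoeff (σ := Fin n) (R := k))).comp
      (finSuccEquiv k n).toRingEquiv.toRingHom with hθ
  have hcoef : ∀ g, coeff (Finsupp.single 0 W) g = PowerSeries.coeff W (θ g) := by
    intro g
    have : PowerSeries.coeff W (θ g) = coeff 0 (PowerSeries.coeff W (finSuccEquiv k n g)) := by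
      simp [hθ]
    rw [this, coeff_coeff_finSuccEquiv, Finsupp.cons_zero_eq_single_zero]
  have hθprod : ∀ d : Fin (n + 1) →₀ ℕ,
      θ (d.prod fun i m => (Fin.cons (X 0) fun j => X j.succ + C 1 * X 0 ^ N j :
        Fin (n + 1) → MvPowerSeries (Fin (n + 1)) k) i ^ m) = PowerSeries.X ^ (∑ i : Fin (n + 1), B ^ (i : ℕ) * d i) := by
    intro d
    rw [Finsupp.prod_fintype _ _ (by simp), map_prod, ← Finset.prod_pow_eq_pow_sum]
    refine Finset.prod_congr rfl fun i _ => ?_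
    rw [map_pow, pow_mul]
    congr 1
    refine Fin.cases ?_ (fun j => ?_) i
    · simp [hθ]
    · simp [hθ, hNdef]
  have hval : coeff (Finsupp.single 0 W) (substAlgHom h1 f) = coeff e f := by
    rw [coe_substAlgHom, coeff_subst h1, finsum_eq_single _ e]
    · rw [hcoef, hθprod]; simp [W]
    · intro d hd
      rw [hcoef, hθprod, PowerSeries.coeff_X_pow]
      split_ifs with h
      · by_cases hdf : coeff d f = 0
        · simp [hdf]
        · exact absurd (huniq d hdf h.symm) hd
      · simp
  have h3 := congrArg (PowerSeries.coeff W) h0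
  simp only [PowerSeries.coeff_map, map_zero, AlgEquiv.ofAlgHom_apply] at h3
  rw [IsLocalRing.residue_eq_zero_iff, IsLocalRing.mem_maximalIdeal, mem_nonunits_iff,
    isUnit_iff_constantCoeff, isUnit_iff_ne_zero, not_not] at h3
  rw [hcoef] at hval
  apply he
  rw [← hval]
  simpa [hθ] using h3

theorem isDomain_of_field (σ : Type*) : IsDomain (MvPowerSeries σ k) :=
  NoZeroDivisors.to_isDomain _

theorem maximalIdeal_eq_span_range_X {n : ℕ} :
    IsLocalRing.maximalIdeal (MvPowerSeries (Fin n) k) = Ideal.span (Set.range X) := by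
  have hmem : ∀ f : MvPowerSeries (Fin n) k,
      f ∈ IsLocalRing.maximalIdeal (MvPowerSeries (Fin n) k) ↔ constantCoeff f = 0 := fun f => by
    rw [IsLocalRing.mem_maximalIdeal, mem_nonunits_iff, isUnit_iff_constantCoeff,
      isUnit_iff_ne_zero, not_not]
  apply le_antisymm
  -- Induction on the variables: the part `g` of `f` free of `X_i` falls to the inductive
  -- hypothesis, and `X_i` divides `f - g`.
  · have key : ∀ (T : Finset (Fin n)) (f : MvPowerSeries (Fin n) k),
        (∀ m, (∀ i ∈ T, m i = 0) → coeff m f = 0) → f ∈ Ideal.span (Set.range (X (R := k))) := by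
      classical
      intro T
      induction T using Finset.induction_on with
      | empty =>
        intro f hf
        have : f = 0 := MvPowerSeries.ext fun m => by simpa using hf m (by simp)
        rw [this]; exact zero_mem _
      | insert i T _ ih =>
        intro f hf
        let g : MvPowerSeries (Fin n) k := fun m => if m i = 0 then coeff m f else 0
        have hg : ∀ m, coeff m g = if m i = 0 then coeff m f else 0 := fun m => rfl
        have h1 : g ∈ Ideal.span (Set.range (X (R := k))) := by
          refine ih g fun m hm => ?_
          rw [hg]
          split_ifs with h0
          · exact hf m fun j hj => by
              rcases Finset.mem_insert.1 hj with rfl | hj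
              · exact h0
              · exact hm j hj
          · rfl
        have h2 : X i ∣ f - g := by
          rw [X_dvd_iff]
          intro m hm
          rw [map_sub, hg, if_pos hm, sub_self]
        rw [← sub_add_cancel f g]
        exact add_mem (Ideal.mem_of_dvd _ h2 (Ideal.subset_span ⟨i, rfl⟩)) h1
    intro f hf
    refine key Finset.univ f fun m hm => ?_
    have : m = 0 := Finsupp.ext fun i => hm i (Finset.mem_univ i)
    rw [this]; exact (hmem f).1 hf
  · rw [Ideal.span_le]
    rintro _ ⟨i, rfl⟩
    exact (hmem _).2 (by simp)

theorem uniqueFactorizationMonoid_fin (n : ℕ) : UniqueFactorizationMonoid (MvPowerSeries (Fin n) k) := by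
  induction n with
  | zero => exact (isEmptyEquiv (R := k) (Fin 0)).symm.toMulEquiv.uniqueFactorizationMonoid inferInstance
  | succ n ih =>
    have := isDomain_of_field (k := k) (Fin n)
    have := isDomain_of_field (k := k) (Fin (n + 1))
    have : IsAdicComplete (IsLocalRing.maximalIdeal (MvPowerSeries (Fin n) k)) (MvPowerSeries (Fin n) k) := by
      rw [maximalIdeal_eq_span_range_X]; infer_instance
    have : IsWellFounded (MvPowerSeries (Fin (n + 1)) k) DvdNotUnit := IsNoetherianRing.wfDvdMonoid
    refine UniqueFactorizationMonoid.mk ?_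
    intro f
    refine ⟨fun hf => ?_, fun hf => hf.irreducible⟩
    obtain ⟨φ, hφ⟩ := exists_algEquiv_map_residue_ne_zero hf.ne_zero
    have h1 : Irreducible ((φ.trans (finSuccEquiv k n)) f) := (MulEquiv.irreducible_iff _).2 hf
    exact (MulEquiv.prime_iff (φ.trans (finSuccEquiv k n))).1
      (PowerSeries.prime_of_irreducible_of_map_residue_ne_zero h1 hφ)

end MvPowerSeries
end

/-! ### Orders of power series and an Artin–Schreier equation without solutions. -/

section
namespace MvPowerSeries
variable {k : Type*} [Field k] {p : ℕ} [hp : Fact p.Prime] [CharP k p] {σ : Type*}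

theorem coeff_smul_pow_char [Finite σ] (f : MvPowerSeries σ k) (m : σ →₀ ℕ) :
    coeff (p • m) (f ^ p) = coeff m f ^ p := by
  have : ExpChar k p := ExpChar.prime hp.out
  rw [← map_frobenius_expand p hp.out.ne_zero, coeff_map, coeff_expand_smul]
  rfl

theorem coeff_pow_char_of_not_dvd [Finite σ] (f : MvPowerSeries σ k) {m : σ →₀ ℕ} {i : σ}
    (h : ¬ p ∣ m i) : coeff m (f ^ p) = 0 := by
  have : ExpChar k p := ExpChar.prime hp.out
  rw [← map_frobenius_expand p hp.out.ne_zero, coeff_map,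
    coeff_expand_of_not_dvd p hp.out.ne_zero f h, map_zero]

theorem le_order_pow_mul {c g : MvPowerSeries σ k} {N M : ℕ} (q : ℕ) (hc : (N : ℕ∞) ≤ c.order)
    (hg : (M : ℕ∞) ≤ g.order) : ((q * N + M : ℕ) : ℕ∞) ≤ (c ^ q * g).order := by
  refine le_trans ?_ le_order_mul
  push_cast
  refine add_le_add ?_ hg
  refine le_trans ?_ (le_order_pow q)
  rw [nsmul_eq_mul]
  gcongr

/-- An Artin–Schreier type equation without solutions: comparing orders, a monomial whose degree
is `1` modulo `p` on the right cannot be matched on the left. -/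
theorem pow_sub_pow_mul_ne_sum {n : ℕ} {T : Finset (Fin n)} (hT : T.Nonempty)
    {b : Fin n → MvPowerSeries (Fin n) k} (hb : ∀ i ∈ T, b i ≠ 0)
    {t : Fin n → k} (ht : ∀ i ∈ T, t i ≠ 0) {c : MvPowerSeries (Fin n) k}
    (hc : ∀ i ∈ T, (b i).order < c.order) (g : MvPowerSeries (Fin n) k) :
    g ^ p - c ^ (p - 1) * g ≠ ∑ i ∈ T, C (t i) * b i ^ p * X i := by
  intro h
  have hp1 := hp.out.two_le
  -- With `e` the least order of the `b_i`, the right side has order at least `p e + 1`, and `c` has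
  -- order at least `e + 1`.
  obtain ⟨i₀, hi₀, hmin⟩ := T.exists_min_image (fun i => (b i).order) hT
  have hfin := ne_zero_iff_order_finite.1 (hb i₀ hi₀)
  obtain ⟨m, hm, hme⟩ := exists_coeff_ne_zero_and_order hfin
  set e := m.degree with he
  have hc' : ((e + 1 : ℕ) : ℕ∞) ≤ c.order := by
    have := hc i₀ hi₀
    rw [← hme] at this
    push_cast
    exact Order.add_one_le_of_lt this
  have hR : ∀ d : Fin n →₀ ℕ, d.degree < p * e + 1 →
      coeff d (∑ i ∈ T, C (t i) * b i ^ p * X i) = 0 := by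
    intro d hd
    rw [map_sum]
    refine Finset.sum_eq_zero fun i hi => ?_
    rw [mul_assoc, coeff_C_mul]
    have h1 : ((p * e + 1 : ℕ) : ℕ∞) ≤ (b i ^ p * X i).order := by
      refine le_order_pow_mul p (hme ▸ hmin i hi) ?_
      simp [X, order_monomial_of_ne_zero]
    rw [coeff_of_lt_order (lt_of_lt_of_le (by exact_mod_cast hd) h1), mul_zero]
  -- If `g` has order at most `e`, the lowest term of `g ^ p` lies below the orders of both `c ^ (p
  -- - 1) g` and the right side, so nothing cancels it.
  by_cases hg : g.order ≤ e
  · have hg0 : g ≠ 0 := by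
      rintro rfl
      simp at hg
    obtain ⟨m', hm', hm'e⟩ := exists_coeff_ne_zero_and_order (ne_zero_iff_order_finite.1 hg0)
    have hle : m'.degree ≤ e := by rw [← hm'e] at hg; exact_mod_cast hg
    have hdeg : (p • m').degree = p * m'.degree := by simp
    have h1 := congrArg (coeff (p • m')) h
    rw [hR _ (by rw [hdeg]; nlinarith), map_sub, coeff_smul_pow_char, coeff_of_lt_order
      (lt_of_lt_of_le _ (le_order_pow_mul (p - 1) hc' hm'e.le)), sub_zero] at h1
    · exact hm' (pow_eq_zero_iff hp.out.ne_zero |>.1 h1)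
    · rw [hdeg]
      norm_cast
      obtain ⟨q, rfl⟩ : ∃ q, p = q + 2 := ⟨p - 2, by omega⟩
      have : q + 2 - 1 = q + 1 := by omega
      rw [this]
      nlinarith
  · have hg' : ((e + 1 : ℕ) : ℕ∞) ≤ g.order := by
      push_cast
      exact Order.add_one_le_of_lt (not_le.1 hg)
    -- Otherwise the left side has no monomial at `p m + e_{i₀}`: the exponent is not divisible by
    -- `p`, and `c ^ (p - 1) g` has order at least `p (e + 1) > p e + 1`. On the right only the `i₀`
    -- term reaches it.
    have hnd : ¬ p ∣ (p • m + Finsupp.single i₀ 1 : Fin n →₀ ℕ) i₀ := by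
      simp only [Finsupp.add_apply, Finsupp.smul_apply, Finsupp.single_eq_same, smul_eq_mul]
      rw [← Nat.dvd_add_iff_right (dvd_mul_right _ _)]
      exact hp.out.one_lt.ne' ∘ Nat.dvd_one.1
    have hdeg : (p • m + Finsupp.single i₀ 1).degree = p * e + 1 := by simp [he]
    have h1 := congrArg (coeff (p • m + Finsupp.single i₀ 1)) h
    rw [map_sub, coeff_pow_char_of_not_dvd _ hnd, coeff_of_lt_order
      (lt_of_lt_of_le _ (le_order_pow_mul (p - 1) hc' hg')), sub_zero, map_sum,
      Finset.sum_eq_single i₀] at h1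
    · rw [mul_assoc, coeff_C_mul, X, coeff_add_mul_monomial, mul_one, coeff_smul_pow_char] at h1
      exact mul_ne_zero (ht i₀ hi₀) (pow_ne_zero _ hm) h1.symm
    · intro i _ hne
      rw [mul_assoc, coeff_C_mul, X, coeff_mul_monomial]
      split_ifs with hle
      · have : ¬ p ∣ (p • m + Finsupp.single i₀ 1 - Finsupp.single i 1 : Fin n →₀ ℕ) i₀ := by
          rwa [Finsupp.tsub_apply, Finsupp.single_eq_of_ne hne.symm, tsub_zero]
        rw [coeff_pow_char_of_not_dvd _ this]
        simp
      · simp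
    · exact fun hn => absurd hi₀ hn
    · rw [hdeg]
      norm_cast
      obtain ⟨q, rfl⟩ : ∃ q, p = q + 2 := ⟨p - 2, by omega⟩
      have : q + 2 - 1 = q + 1 := by omega
      rw [this]
      nlinarith
end MvPowerSeries
end

/-! ### Artin–Schreier extensions of fields. -/

section
namespace ArtinSchreier
open Polynomial

theorem prod_X_sub_C_cast (p : ℕ) [Fact p.Prime] (S : Type*) [CommRing S] [CharP S p] :
    ∏ j : ZMod p, (X - C (j.cast : S)) = X ^ p - X := by
  have h1 : (X ^ p - X : (ZMod p)[X]).roots = Finset.univ.val := by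
    simpa [ZMod.card] using FiniteField.roots_X_pow_card_sub_X (ZMod p)
  have hmon : (X ^ p - X : (ZMod p)[X]).Monic :=
    monic_X_pow_sub (by simpa using (Fact.out : p.Prime).one_lt)
  have h2 := (GaloisField.splits_zmod_X_pow_sub_X p).eq_prod_roots_of_monic hmon
  rw [h1] at h2
  have h3 := congrArg (Polynomial.map (ZMod.castHom (dvd_refl p) S)) h2
  simp only [Polynomial.map_sub, Polynomial.map_pow, map_X] at h3
  rw [h3]
  change _ = Polynomial.map _ (∏ j : ZMod p, (X - C j))
  simp [Polynomial.map_prod]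

theorem prod_sub_cast {p : ℕ} [Fact p.Prime] {S : Type*} [CommRing S] [CharP S p] (x : S) :
    ∏ j : ZMod p, (x - j.cast) = x ^ p - x := by
  have := congrArg (eval x) (prod_X_sub_C_cast p S)
  simpa [eval_prod] using this

theorem exists_cast_eq {p : ℕ} [Fact p.Prime] {S : Type*} [CommRing S] [IsDomain S] [CharP S p]
    {x : S} (hx : x ^ p = x) : ∃ j : ZMod p, x = j.cast := by
  have h := prod_sub_cast (p := p) x
  rw [hx, sub_self, Finset.prod_eq_zero_iff] at h
  obtain ⟨j, -, hj⟩ := h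
  exact ⟨j, sub_eq_zero.1 hj⟩

theorem cast_add' {p : ℕ} [Fact p.Prime] {S : Type*} [CommRing S] [CharP S p] (i j : ZMod p) :
    ((i + j).cast : S) = i.cast + j.cast := (ZMod.castHom (dvd_refl p) S).map_add i j

theorem cast_inj {p : ℕ} [Fact p.Prime] {S : Type*} [CommRing S] [Nontrivial S] [CharP S p]
    {i j : ZMod p} (h : (i.cast : S) = j.cast) : i = j :=
  (ZMod.castHom (dvd_refl p) S).injective h

theorem map_cast {p : ℕ} [Fact p.Prime] {S T : Type*} [CommRing S] [CommRing T] [CharP S p]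
    {F : Type*} [FunLike F S T] [RingHomClass F S T] (φ : F) (i : ZMod p) : φ i.cast = i.cast := by
  rw [ZMod.cast_eq_val, ZMod.cast_eq_val, map_natCast]

theorem cast_pow_p {p : ℕ} [Fact p.Prime] {S : Type*} [CommRing S] [CharP S p] (i : ZMod p) :
    (i.cast : S) ^ p = i.cast := by
  have h := congrArg (ZMod.castHom (dvd_refl p) S) (ZMod.pow_card i)
  simpa only [map_pow, ZMod.castHom_apply] using h

theorem X_pow_sub_X_sub_C_eq_prod {p : ℕ} [Fact p.Prime] {S : Type*} [CommRing S] [CharP S p]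
    {w b : S} (hw : w ^ p - w = b) :
    (X ^ p - X - C b : S[X]) = ∏ j : ZMod p, (X - C (w + j.cast)) := by
  have h := congrArg (fun q => q.comp (X - C w)) (prod_X_sub_C_cast p S)
  simp only [prod_comp, sub_comp, X_comp, C_comp, pow_comp] at h
  have hw' : ∀ j : ZMod p, (X - C w - C (j.cast : S) : S[X]) = X - C (w + j.cast) := fun j => by
    rw [map_add, sub_sub]
  simp only [hw'] at h
  rw [h, sub_pow_char, ← hw, map_sub, map_pow]
  ring

section
variable {p : ℕ} [hp : Fact p.Prime] {K L : Type*} [Field K] [Field L] [Algebra K L] [CharP K p]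
  {ι : Type*} {w : ι → L} {b : ι → K}

/-- The realized translations form an `𝔽_p`-subspace. If it missed `ν`, a nonzero functional `s`
would vanish on it, and `∑ s_i w_i` would be Galois-invariant, hence in `K`, against `hb`. The `w_i`
need not generate `L`. -/
theorem exists_algEquiv_apply_eq_add [CharP L p] [Fintype ι] [IsGalois K L]
    (hw : ∀ i, w i ^ p - w i = algebraMap K L (b i))
    (hb : ∀ s : ι → ZMod p, s ≠ 0 → ∀ y : K, y ^ p - y ≠ ∑ i, (s i).cast * b i) (ν : ι → ZMod p) :
    ∃ σ : L ≃ₐ[K] L, ∀ i, σ (w i) = w i + (ν i).cast := by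
  classical
  have hδ : ∀ (σ : L ≃ₐ[K] L) (i : ι), ∃ j : ZMod p, σ (w i) - w i = j.cast := by
    intro σ i
    apply exists_cast_eq
    have h1 := congrArg σ (hw i)
    rw [map_sub, map_pow, AlgEquiv.commutes, ← hw i] at h1
    rw [sub_pow_char]
    linear_combination h1
  choose δ hδ using hδ
  have hδ' : ∀ σ i, σ (w i) = w i + (δ σ i).cast := fun σ i => by rw [← hδ σ i]; ring
  let S : AddSubgroup (ι → ZMod p) :=
    { carrier := Set.range δ
      zero_mem' := ⟨1, funext fun i => cast_inj (S := L) (by rw [← hδ]; simp)⟩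
      add_mem' := by
        rintro _ _ ⟨σ, rfl⟩ ⟨τ, rfl⟩
        refine ⟨σ * τ, funext fun i => cast_inj (S := L) ?_⟩
        rw [← hδ, AlgEquiv.mul_apply, hδ' τ, map_add, hδ' σ, map_cast σ, Pi.add_apply,
          cast_add']
        ring
      neg_mem' := by
        rintro _ ⟨σ, rfl⟩
        refine ⟨σ⁻¹, funext fun i => cast_inj (S := L) ?_⟩
        have h1 : σ⁻¹ (σ (w i)) = w i := by rw [← AlgEquiv.mul_apply]; simp
        rw [hδ' σ, map_add, hδ' σ⁻¹] at h1
        rw [map_cast σ⁻¹] at h1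
        have h3 := (ZMod.castHom (dvd_refl p) L).map_neg (δ σ i)
        simp only [ZMod.castHom_apply] at h3
        rw [Pi.neg_apply, h3]
        linear_combination h1 }
  by_contra hν
  have hνS : ν ∉ AddSubgroup.toZModSubmodule p S := by
    rintro ⟨σ, rfl⟩
    exact hν ⟨σ, hδ' σ⟩
  obtain ⟨F, hF, hSF⟩ := Submodule.exists_le_ker_of_notMem hνS
  set s : ι → ZMod p := fun i => F (Pi.single i 1) with hs
  have hFs : ∀ v, F v = ∑ i, s i * v i := by
    intro v
    conv_lhs => rw [pi_eq_sum_univ' v]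
    simp [map_sum, hs, mul_comm]
  have hs0 : s ≠ 0 := by
    intro h
    apply hF
    rw [hFs, h]; simp
  obtain ⟨y, hy⟩ : ∑ i, ((s i).cast : L) * w i ∈ Set.range (algebraMap K L) := by
    rw [InfiniteGalois.mem_range_algebraMap_iff_fixed]
    intro σ
    have h1 : F (δ σ) = 0 := hSF (show δ σ ∈ S from ⟨σ, rfl⟩)
    rw [hFs] at h1
    have h2 := congrArg (ZMod.castHom (dvd_refl p) L) h1
    simp only [map_sum, map_mul, map_zero, ZMod.castHom_apply] at h2
    rw [map_sum]
    have h3 : ∀ i, σ (((s i).cast : L) * w i) = (s i).cast * w i + (s i).cast * (δ σ i).cast := by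
      intro i
      rw [map_mul, hδ' σ, map_cast σ]
      ring
    simp only [h3, Finset.sum_add_distrib, h2, add_zero]
  refine hb s hs0 y (algebraMap K L |>.injective ?_)
  rw [map_sub, map_pow, hy, sum_pow_char, map_sum, ← Finset.sum_sub_distrib]
  refine Finset.sum_congr rfl fun i _ => ?_
  rw [map_mul, map_cast, mul_pow, cast_pow_p, ← hw]
  ring

/-- The polynomial `X ^ p - X - b_i` has derivative `-1`, and all its roots `w_i + j` lie in `L`. -/
theorem isGalois_of_adjoin_eq_top [CharP L p] (hw : ∀ i, w i ^ p - w i = algebraMap K L (b i))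
    (htop : IntermediateField.adjoin K (Set.range w) = ⊤) : IsGalois K L := by
  have hmonic : ∀ i, (X ^ p - X - C (b i) : K[X]).Monic := fun i => by
    rw [sub_sub]
    refine monic_X_pow_sub ?_
    refine lt_of_le_of_lt (degree_add_le _ _) (max_lt ?_ ?_)
    · rw [degree_X]; exact_mod_cast hp.out.one_lt
    · exact lt_of_le_of_lt degree_C_le (by exact_mod_cast hp.out.pos)
  have hroot : ∀ i, aeval (w i) (X ^ p - X - C (b i) : K[X]) = 0 := fun i => by
    simp [hw]
  have hint : ∀ i, IsIntegral K (w i) := fun i => ⟨_, hmonic i, hroot i⟩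
  have hsep : ∀ i, (X ^ p - X - C (b i) : K[X]).Separable := fun i => by
    rw [separable_def]
    have : derivative (X ^ p - X - C (b i) : K[X]) = -1 := by simp [derivative_X_pow]
    rw [this]
    exact isCoprime_one_right.neg_right
  have : Algebra.IsSeparable K L := by
    rw [← IntermediateField.isSeparable_top, ← htop, IntermediateField.isSeparable_adjoin_iff_isSeparable]
    rintro _ ⟨i, rfl⟩
    exact (hsep i).of_dvd (minpoly.dvd K _ (hroot i))
  have : Normal K L := by
    refine ⟨fun {x} => ?_⟩
    refine IntermediateField.splits_of_mem_adjoin (F := K) (K := L) (S := Set.range w) ?_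
      (htop.symm ▸ IntermediateField.mem_top)
    rintro _ ⟨i, rfl⟩
    refine ⟨hint i, ?_⟩
    refine Splits.of_dvd ?_ ?_ (Polynomial.map_dvd (algebraMap K L) (minpoly.dvd K _ (hroot i)))
    · have : (X ^ p - X - C (b i) : K[X]).map (algebraMap K L) = X ^ p - X - C (algebraMap K L (b i)) := by simp
      rw [this, X_pow_sub_X_sub_C_eq_prod (hw i)]
      exact Splits.prod fun _ _ => Splits.X_sub_C _
    · exact ((hmonic i).map _).ne_zero
  exact ⟨⟩

theorem exists_mulEquiv [CharP L p] [Fintype ι] (hw : ∀ i, w i ^ p - w i = algebraMap K L (b i))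
    (hb : ∀ s : ι → ZMod p, s ≠ 0 → ∀ y : K, y ^ p - y ≠ ∑ i, (s i).cast * b i)
    (htop : IntermediateField.adjoin K (Set.range w) = ⊤) :
    ∃ Φ : Multiplicative (ι → ZMod p) ≃* (L ≃ₐ[K] L),
      ∀ ν i, Φ (Multiplicative.ofAdd ν) (w i) = w i + (ν i).cast := by
  have := isGalois_of_adjoin_eq_top hw htop
  have hext : ∀ σ τ : L ≃ₐ[K] L, (∀ i, σ (w i) = τ (w i)) → σ = τ := by
    intro σ τ h
    have h1 : (σ : L →ₐ[K] L) = τ := by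
      have h2 : ∀ x ∈ IntermediateField.adjoin K (Set.range w), σ x = τ x := by
        intro x hx
        induction hx using IntermediateField.adjoin_induction with
        | mem x hx => obtain ⟨i, rfl⟩ := hx; exact h i
        | algebraMap x => simp
        | add x y _ _ hx hy => simp [hx, hy]
        | inv x _ hx => simp [hx]
        | mul x y _ _ hx hy => simp [hx, hy]
      ext x
      exact h2 x (htop ▸ trivial)
    ext x
    exact DFunLike.congr_fun h1 x
  choose φ hφ using exists_algEquiv_apply_eq_add hw hb
  have hinj : Function.Injective fun ν : Multiplicative (ι → ZMod p) => φ ν.toAdd := by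
    intro ν ν' h
    refine Multiplicative.toAdd.injective (funext fun i => cast_inj (S := L) ?_)
    have := DFunLike.congr_fun h (w i)
    simpa [hφ] using this
  have hmul : ∀ ν ν' : Multiplicative (ι → ZMod p), φ (ν * ν').toAdd = φ ν.toAdd * φ ν'.toAdd := by
    intro ν ν'
    refine hext _ _ fun i => ?_
    rw [AlgEquiv.mul_apply, hφ, hφ, map_add, hφ, map_cast (φ ν.toAdd),
      toAdd_mul, Pi.add_apply, cast_add']
    ring
  have hsurj : Function.Surjective fun ν : Multiplicative (ι → ZMod p) => φ ν.toAdd := by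
    intro σ
    have hδ : ∀ i, ∃ j : ZMod p, σ (w i) - w i = j.cast := by
      intro i
      apply exists_cast_eq
      have h1 := congrArg σ (hw i)
      rw [map_sub, map_pow, AlgEquiv.commutes, ← hw i] at h1
      rw [sub_pow_char]
      linear_combination h1
    choose δ hδ using hδ
    refine ⟨Multiplicative.ofAdd δ, hext _ _ fun i => ?_⟩
    simp only [toAdd_ofAdd, hφ, ← hδ]
    ring
  exact ⟨MulEquiv.ofBijective (MonoidHom.mk' (fun ν : Multiplicative (ι → ZMod p) => φ ν.toAdd) hmul)
    ⟨hinj, hsurj⟩, fun ν i => hφ ν i⟩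
end
end ArtinSchreier
end

/-! ### Subgroups of order `p ^ (n - 1)` as kernels of functionals. -/

section
namespace ArtinSchreierTower
theorem perp_card {p n : ℕ} [Fact p.Prime] {s : Fin n → ZMod p} (hs : s ≠ 0) :
    Nat.card (perp s) = p ^ (n - 1) := by
  let F : (Fin n → ZMod p) →ₗ[ZMod p] ZMod p :=
    { toFun := fun v => ∑ i, v i * s i
      map_add' := fun x y => by simp [add_mul, Finset.sum_add_distrib]
      map_smul' := fun c x => by simp [Finset.mul_sum, mul_assoc] }
  have hF : F ≠ 0 := by
    intro h
    refine hs (funext fun i => ?_)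
    have := LinearMap.congr_fun h (Pi.single i 1)
    simpa [F, Pi.single_apply] using this
  have h1 : Module.finrank (ZMod p) (LinearMap.ker F) = n - 1 := by
    have h2 := LinearMap.finrank_range_add_finrank_ker F
    rw [LinearMap.range_eq_top.2 (LinearMap.surjective hF)] at h2
    simp at h2
    omega
  have h3 : Nat.card (perp s) = Nat.card (LinearMap.ker F) :=
    Nat.card_congr (Equiv.refl (Fin n → ZMod p) |>.subtypeEquiv fun _ => Iff.rfl)
  rw [h3, Module.natCard_eq_pow_finrank (K := ZMod p), h1, Nat.card_zmod]

/-- A subgroup of this order is a proper `𝔽_p`-subspace, so it lies in the kernel of a nonzero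
functional, which has the same cardinality. -/
theorem card_eq_iff_exists_perp {p n : ℕ} [Fact p.Prime] (hn : n ≠ 0)
    (H : Subgroup (Multiplicative (Fin n → ZMod p))) :
    Nat.card H = p ^ (n - 1) ↔ ∃ s : Fin n → ZMod p, s ≠ 0 ∧ H = perp s := by
  classical
  constructor
  · intro hH
    set S := AddSubgroup.toZModSubmodule p (Subgroup.toAddSubgroup' H) with hS
    have hcard : Nat.card S = p ^ (n - 1) := hH
    have hlt : S ≠ ⊤ := by
      intro h
      rw [h] at hcard
      have h2 : Nat.card (⊤ : Submodule (ZMod p) (Fin n → ZMod p)) = p ^ n := by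
        rw [Module.natCard_eq_pow_finrank (K := ZMod p), finrank_top]
        simp
      rw [h2] at hcard
      have := Nat.pow_right_injective (Fact.out : p.Prime).two_le hcard
      omega
    obtain ⟨v, hv⟩ : ∃ v, v ∉ S := by
      by_contra! h
      exact hlt (eq_top_iff.2 fun x _ => h x)
    obtain ⟨F, hF, hSF⟩ := Submodule.exists_le_ker_of_notMem hv
    have hFs : ∀ v, F v = ∑ i, v i * F (Pi.single i 1) := by
      intro v
      conv_lhs => rw [pi_eq_sum_univ' v]
      simp [map_sum]
    have hs : (fun i => F (Pi.single i 1)) ≠ 0 := by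
      intro h
      apply hF
      rw [hFs]
      exact Finset.sum_eq_zero fun i _ => by rw [congrFun h i]; simp
    refine ⟨_, hs, ?_⟩
    apply Subgroup.eq_of_le_of_card_ge
    · intro x hx
      have h1 : F x.toAdd = 0 := hSF (show x.toAdd ∈ S from hx)
      rw [hFs] at h1
      exact h1
    · rw [perp_card hs, hH]
  · rintro ⟨s, hs, rfl⟩
    exact perp_card hs
end ArtinSchreierTower
end

/-! ### Polynomials of degree less than `p` in each variable. -/

section
namespace MvPolynomial

theorem degreeOf_map_le {S T ι : Type*} [CommSemiring S] [CommSemiring T] (φ : S →+* T)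
    (P : MvPolynomial ι S) (i : ι) : (map φ P).degreeOf i ≤ P.degreeOf i :=
  degreeOf_le_iff.2 fun _ hm => degreeOf_le_iff.1 le_rfl _ (support_map_subset φ P hm)

/-- `P - b` vanishes on a grid with `p` distinct values per coordinate, more than its degree in each
variable. -/
theorem eq_C_of_eval_translate_eq {p : ℕ} [hp : Fact p.Prime] {L : Type*} [CommRing L] [IsDomain L]
    [CharP L p] {ι : Type*} [Finite ι] {w c : ι → L} (hc : ∀ i, c i ≠ 0) {P : MvPolynomial ι L}
    (hP : ∀ i, P.degreeOf i < p) {b : L}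
    (h : ∀ ν : ι → ZMod p, eval (fun i => w i + (ν i).cast * c i) P = b) : P = C b := by
  classical
  rw [← sub_eq_zero]
  have hinj : ∀ i, Function.Injective fun j : ZMod p => w i + j.cast * c i := fun i j j' hj =>
    ArtinSchreier.cast_inj (S := L) (mul_right_cancel₀ (hc i) (add_left_cancel hj))
  refine eq_zero_of_eval_zero_at_prod_finset _
    (fun i => Finset.univ.image fun j : ZMod p => w i + j.cast * c i) (fun i => ?_) (fun x hx => ?_)
  · rw [Finset.card_image_of_injective _ (hinj i), Finset.card_univ, ZMod.card]
    refine lt_of_le_of_lt (degreeOf_sub_le i P (C b)) (max_lt (hP i) ?_)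
    rw [degreeOf_C]; exact hp.out.pos
  · simp only [Finset.mem_image, Finset.mem_univ, true_and] at hx
    choose ν hν using hx
    rw [map_sub, eval_C, ← _root_.funext hν, h, sub_self]

theorem exists_degreeOf_lt_aeval_eq {p : ℕ} (hp : 1 < p) {S D : Type*} [CommRing S] [CommRing D]
    [Algebra S D] {ι : Type*} {w : ι → D}
    (hw : ∀ i, ∃ c x : S, w i ^ p = c • w i + algebraMap S D x) {y : D}
    (hy : y ∈ Algebra.adjoin S (Set.range w)) :
    ∃ P : MvPolynomial ι S, (∀ i, P.degreeOf i < p) ∧ aeval w P = y := by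
  classical
  set T : Submodule S D := (restrictDegree ι S (p - 1)).map (aeval w).toLinearMap with hT
  have hmono : ∀ m : ι →₀ ℕ, (∀ i, m i ≤ p - 1) → aeval w (monomial m (1 : S)) ∈ T := by
    intro m hm
    refine ⟨_, ?_, rfl⟩
    rw [SetLike.mem_coe, mem_restrictDegree]
    intro s hs i
    rw [Finset.mem_singleton.1 (support_monomial_subset hs)]
    exact hm i
  have hadd : ∀ (m : ι →₀ ℕ) (i : ι) (r : ℕ), aeval w (monomial (m + Finsupp.single i r) (1 : S))
      = aeval w (monomial m (1 : S)) * w i ^ r := by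
    intro m i r
    rw [monomial_add_single, map_mul, map_pow, aeval_X]
  have hmul : ∀ t ∈ T, ∀ i, t * w i ∈ T := by
    rintro _ ⟨P, hP, rfl⟩ i
    rw [SetLike.mem_coe, mem_restrictDegree] at hP
    rw [AlgHom.toLinearMap_apply, P.as_sum, map_sum, Finset.sum_mul]
    refine Submodule.sum_mem _ fun m hm => ?_
    have h1 : aeval w (monomial m (coeff m P)) = coeff m P • aeval w (monomial m (1 : S)) := by
      rw [← map_smul, smul_monomial, smul_eq_mul, mul_one]
    rw [h1, smul_mul_assoc]
    refine Submodule.smul_mem _ _ ?_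
    by_cases hlt : m i + 1 < p
    · have := hadd m i 1
      rw [pow_one] at this
      rw [← this]
      refine hmono _ fun j => ?_
      rw [Finsupp.add_apply, Finsupp.single_apply]
      split_ifs with hij
      · subst hij; omega
      · exact hP m hm j
    -- The exponent of `w_i` has reached `p`; the relation replaces it by `1` and `0`, both at most
    -- `p - 1`.
    · have hmi : m i + 1 = p := by have := hP m hm i; omega
      obtain ⟨c, x, hcx⟩ := hw i
      have h2 : aeval w (monomial m (1 : S)) * w i = aeval w (monomial (m.erase i) (1 : S)) * w i ^ p := by
        rw [← hmi, pow_succ, ← mul_assoc, ← hadd, Finsupp.erase_add_single]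
      have h3 := hadd (m.erase i) i 1
      rw [pow_one] at h3
      have her : ∀ j, m.erase i j ≤ p - 1 := fun j => by
        rw [Finsupp.erase_apply]
        split_ifs
        · omega
        · exact hP m hm j
      rw [h2, hcx, mul_add, mul_smul_comm, ← h3, mul_comm _ (algebraMap S D x), ← Algebra.smul_def]
      refine add_mem (Submodule.smul_mem _ _ (hmono _ fun j => ?_)) (Submodule.smul_mem _ _ (hmono _ her))
      rw [Finsupp.add_apply, Finsupp.single_apply]
      split_ifs with hij
      · subst hij; rw [Finsupp.erase_same]; omega
      · exact her j
  have hall : ∀ Q : MvPolynomial ι S, aeval w Q ∈ T := by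
    intro Q
    induction Q using MvPolynomial.induction_on with
    | C a =>
      have := Submodule.smul_mem T a (hmono 0 (by simp))
      rwa [← map_smul, smul_monomial, smul_eq_mul, mul_one] at this
    | add P Q hP hQ => rw [map_add]; exact add_mem hP hQ
    | mul_X P i hP => rw [map_mul, aeval_X]; exact hmul _ hP i
  rw [Algebra.adjoin_range_eq_range_aeval] at hy
  obtain ⟨Q, rfl⟩ := hy
  obtain ⟨P, hP, hPQ⟩ := hall Q
  rw [SetLike.mem_coe, mem_restrictDegree] at hP
  exact ⟨P, fun i => lt_of_le_of_lt (degreeOf_le_iff.2 fun m hm => hP m hm i) (by omega), hPQ⟩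
end MvPolynomial
end

/-! ### The presentation of `A`, and the absence of Artin–Schreier roots in `R` and `Frac(R)`. -/

section
namespace ArtinSchreierTower
variable {k : Type*} [Field k] {n p : ℕ} {a : Fin n → MvPowerSeries (Fin n) k}
  {μ : MvPowerSeries (Fin n) k}

/-- The quotient map onto `A`. -/
noncomputable def towerMk (p : ℕ) (a : Fin n → MvPowerSeries (Fin n) k) (μ : MvPowerSeries (Fin n) k) :
    MvPolynomial (Fin n) (MvPowerSeries (Fin n) k) →ₐ[MvPowerSeries (Fin n) k] Tower p a μ :=
  Ideal.Quotient.mkₐ _ _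

theorem towerMk_X (i : Fin n) : towerMk p a μ (MvPolynomial.X i) = u p a μ i := rfl

theorem towerMk_surjective : Function.Surjective (towerMk p a μ) :=
  Ideal.Quotient.mk_surjective

theorem u_pow (i : Fin n) : u p a μ i ^ p =
    algebraMap (MvPowerSeries (Fin n) k) (Tower p a μ) ((μ * a i) ^ (p - 1)) * u p a μ i +
      algebraMap (MvPowerSeries (Fin n) k) (Tower p a μ) (MvPowerSeries.X i) := by
  have h : towerMk p a μ (MvPolynomial.X i ^ p -
      MvPolynomial.C ((μ * a i) ^ (p - 1)) * MvPolynomial.X i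
        - MvPolynomial.C (MvPowerSeries.X i)) = 0 :=
    Ideal.Quotient.eq_zero_iff_mem.2 (Ideal.subset_span ⟨i, rfl⟩)
  rw [← MvPolynomial.algebraMap_eq, map_sub, map_sub, map_mul, map_pow, towerMk_X,
    AlgHom.commutes, AlgHom.commutes, sub_sub, sub_eq_zero] at h
  exact h

theorem adjoin_range_u :
    Algebra.adjoin (MvPowerSeries (Fin n) k) (Set.range (u p a μ)) = ⊤ := by
  rw [Algebra.adjoin_range_eq_range_aeval, eq_top_iff]
  rintro y -
  obtain ⟨P, rfl⟩ := towerMk_surjective y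
  refine ⟨P, ?_⟩
  have h : MvPolynomial.aeval (u p a μ) = towerMk p a μ :=
    MvPolynomial.algHom_ext fun i => by rw [MvPolynomial.aeval_X, towerMk_X]
  exact DFunLike.congr_fun h P

theorem exists_algHom {D : Type*} [CommRing D] [Algebra (MvPowerSeries (Fin n) k) D] (v : Fin n → D)
    (hv : ∀ i, v i ^ p = algebraMap _ D ((μ * a i) ^ (p - 1)) * v i +
      algebraMap (MvPowerSeries (Fin n) k) D (MvPowerSeries.X i)) :
    ∃ φ : Tower p a μ →ₐ[MvPowerSeries (Fin n) k] D, ∀ i, φ (u p a μ i) = v i := by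
  refine ⟨Ideal.Quotient.liftₐ _ (MvPolynomial.aeval v) ?_, fun i => ?_⟩
  · intro x hx
    refine (Ideal.span_le (I := RingHom.ker (MvPolynomial.aeval v))).2 ?_ hx
    rintro _ ⟨i, rfl⟩
    rw [SetLike.mem_coe, RingHom.mem_ker]
    simp only [map_sub, map_mul, map_pow, MvPolynomial.aeval_X, MvPolynomial.aeval_C]
    rw [hv]
    simp
  · exact MvPolynomial.aeval_X v i

theorem alpha_eq_mul_alphaDiv {s : Fin n → ZMod p} {i : Fin n} (hi : i ∈ supp s) :
    alpha a s = a i * alphaDiv a s i := (Finset.mul_prod_erase _ _ hi).symm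

theorem supp_nonempty {s : Fin n → ZMod p} (hs : s ≠ 0) : (supp s).Nonempty := by
  by_contra h
  rw [Finset.not_nonempty_iff_eq_empty, supp, Finset.filter_eq_empty_iff] at h
  exact hs (funext fun i => not_not.1 (h (Finset.mem_univ i)))

variable [hp : Fact p.Prime] [CharP k p]

instance charP_mvPowerSeries {σ : Type*} : CharP (MvPowerSeries σ k) p :=
  charP_of_injective_ringHom (f := MvPowerSeries.C) MvPowerSeries.C_injective p

/-- The order comparison applies because `α = a_i α_i` with `a_i` in the maximal ideal, so `μ α` has
order greater than `α_i`. -/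
theorem f_no_root {s : Fin n → ZMod p} (hs : s ≠ 0) (ha0 : ∀ i, a i ≠ 0)
    (ha : ∀ i, a i ∈ IsLocalRing.maximalIdeal (MvPowerSeries (Fin n) k))
    (g : MvPowerSeries (Fin n) k) :
    g ^ p - (μ * alpha a s) ^ (p - 1) * g ≠
      ∑ i ∈ supp s, ((s i).cast : MvPowerSeries (Fin n) k) * alphaDiv a s i ^ p * MvPowerSeries.X i := by
  have := MvPowerSeries.pow_sub_pow_mul_ne_sum (p := p) (supp_nonempty hs) (b := alphaDiv a s)
    (fun i _ => Finset.prod_ne_zero_iff.2 fun j _ => ha0 j) (t := fun i => (s i).cast)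
    (fun i hi h => (Finset.mem_filter.1 hi).2 (ArtinSchreier.cast_inj (S := k) (by simpa using h)))
    (c := μ * alpha a s) (fun i hi => ?_) g
  · simpa only [ArtinSchreier.map_cast] using this
  · rw [alpha_eq_mul_alphaDiv hi, ← mul_assoc, MvPowerSeries.order_mul, MvPowerSeries.order_mul]
    have h1 : (1 : ℕ∞) ≤ (a i).order := by
      rw [MvPowerSeries.one_le_order_iff_constCoeff_eq_zero]
      have := ha i
      rwa [IsLocalRing.mem_maximalIdeal, mem_nonunits_iff, MvPowerSeries.isUnit_iff_constantCoeff,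
        isUnit_iff_ne_zero, not_not] at this
    have h2 : (alphaDiv a s i).order ≠ ⊤ := by
      rw [Ne, MvPowerSeries.order_eq_top_iff]
      exact Finset.prod_ne_zero_iff.2 fun j _ => ha0 j
    calc (alphaDiv a s i).order < 1 + (alphaDiv a s i).order := by
            rw [add_comm]; exact (ENat.lt_add_one_iff h2).2 le_rfl
      _ ≤ _ := by gcongr; exact le_add_left h1

section
variable {K : Type*} [Field K] [Algebra (MvPowerSeries (Fin n) k) K]
  [IsFractionRing (MvPowerSeries (Fin n) k) K]

theorem pow_sub_ne_sum (ha0 : ∀ i, a i ≠ 0)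
    (ha : ∀ i, a i ∈ IsLocalRing.maximalIdeal (MvPowerSeries (Fin n) k)) (hμ : μ ≠ 0)
    (s : Fin n → ZMod p) (hs : s ≠ 0) (y : K) :
    y ^ p - y ≠ ∑ i, ((s i).cast : K) *
      (algebraMap (MvPowerSeries (Fin n) k) K (MvPowerSeries.X i) /
        algebraMap (MvPowerSeries (Fin n) k) K (μ * a i) ^ p) := by
  intro hy
  have := MvPowerSeries.isDomain_of_field (k := k) (Fin n)
  have := MvPowerSeries.uniqueFactorizationMonoid_fin (k := k) n
  have hinj := IsFractionRing.injective (MvPowerSeries (Fin n) k) K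
  set β : MvPowerSeries (Fin n) k := μ * alpha a s with hβ
  set ι := algebraMap (MvPowerSeries (Fin n) k) K
  set r : MvPowerSeries (Fin n) k := ∑ i ∈ supp s,
    ((s i).cast : MvPowerSeries (Fin n) k) * alphaDiv a s i ^ p * MvPowerSeries.X i with hr
  have h1 : (∑ i, ((s i).cast : K) * (ι (MvPowerSeries.X i) / ι (μ * a i) ^ p)) * ι β ^ p = ι r := by
    rw [← Finset.sum_subset (Finset.subset_univ (supp s)), Finset.sum_mul, hr, map_sum]
    · refine Finset.sum_congr rfl fun i hi => ?_
      have h0 : ι (μ * a i) ≠ 0 := (map_ne_zero_iff _ hinj).2 (mul_ne_zero hμ (ha0 i))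
      rw [hβ, alpha_eq_mul_alphaDiv hi, ← mul_assoc μ, map_mul ι (μ * a i), mul_pow,
        map_mul ι _ (MvPowerSeries.X i), map_mul ι _ (_ ^ p), ArtinSchreier.map_cast, map_pow]
      generalize ι (μ * a i) = c at h0
      field_simp
    · intro i _ hi
      have : s i = 0 := by
        by_contra h
        exact hi (Finset.mem_filter.2 ⟨Finset.mem_univ i, h⟩)
      rw [this, ZMod.cast_zero, zero_mul]
  have hβp : ι β ^ (p - 1) * ι β = ι β ^ p := by
    rw [← pow_succ, Nat.sub_add_cancel hp.out.one_le]
  have h2 : (y * ι β) ^ p - ι β ^ (p - 1) * (y * ι β) = ι r := by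
    rw [← h1, ← hy, mul_pow]
    linear_combination (-y) * hβp
  -- `y β` is integral over `R`, which is integrally closed because it is factorial.
  obtain ⟨g, hg⟩ : ∃ g, ι g = y * ι β := by
    refine (IsIntegrallyClosed.isIntegral_iff (R := MvPowerSeries (Fin n) k)).1 ⟨Polynomial.X ^ p -
      (Polynomial.C (β ^ (p - 1)) * Polynomial.X + Polynomial.C r), ?_, ?_⟩
    · refine Polynomial.monic_X_pow_sub ?_
      refine lt_of_le_of_lt Polynomial.degree_linear_le ?_
      exact_mod_cast hp.out.one_lt
    · simp only [Polynomial.eval₂_sub, Polynomial.eval₂_add, Polynomial.eval₂_mul, Polynomial.eval₂_pow,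
        Polynomial.eval₂_X, Polynomial.eval₂_C]
      change (y * ι β) ^ p - (ι (β ^ (p - 1)) * _ + ι r) = 0
      rw [map_pow]
      linear_combination h2
  refine f_no_root (μ := μ) hs ha0 ha g (hinj ?_)
  rw [map_sub, map_mul, map_pow, map_pow, hg]
  exact h2

variable {L : Type*} [Field L] [Algebra K L] [Algebra (MvPowerSeries (Fin n) k) L]
  [IsScalarTower (MvPowerSeries (Fin n) k) K L]

theorem normalized_root (φ : Tower p a μ →ₐ[MvPowerSeries (Fin n) k] L) (ha0 : ∀ i, a i ≠ 0)
    (hμ : μ ≠ 0) (i : Fin n) :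
    (φ (u p a μ i) / algebraMap _ L (μ * a i)) ^ p - φ (u p a μ i) / algebraMap _ L (μ * a i) =
      algebraMap K L (algebraMap (MvPowerSeries (Fin n) k) K (MvPowerSeries.X i) /
        algebraMap (MvPowerSeries (Fin n) k) K (μ * a i) ^ p) := by
  have := MvPowerSeries.isDomain_of_field (k := k) (Fin n)
  have h0 : algebraMap (MvPowerSeries (Fin n) k) L (μ * a i) ≠ 0 := by
    rw [IsScalarTower.algebraMap_apply (MvPowerSeries (Fin n) k) K L]
    exact (map_ne_zero_iff _ (algebraMap K L).injective).2 ((map_ne_zero_iff _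
      (IsFractionRing.injective (MvPowerSeries (Fin n) k) K)).2 (mul_ne_zero hμ (ha0 i)))
  rw [map_div₀, map_pow, ← IsScalarTower.algebraMap_apply, ← IsScalarTower.algebraMap_apply, div_pow,
    ← map_pow φ, u_pow, map_add, map_mul, AlgHom.commutes, AlgHom.commutes, map_pow]
  set c := algebraMap (MvPowerSeries (Fin n) k) L (μ * a i)
  have hcp : c ^ (p - 1) * c = c ^ p := by
    rw [← pow_succ, Nat.sub_add_cancel hp.out.one_le]
  have hcp0 : c ^ (p - 1) ≠ 0 := pow_ne_zero _ h0
  rw [← hcp]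
  field_simp
  ring
end
end ArtinSchreierTower
end

/-! ### The Galois group, and `A` as a domain. -/

section
namespace ArtinSchreierTower
theorem charP_base (k : Type*) [Field k] (n p : ℕ) [CharP k p] [Fact p.Prime] (K : Type*) [Field K]
    [Algebra (MvPowerSeries (Fin n) k) K] [IsFractionRing (MvPowerSeries (Fin n) k) K] : CharP K p :=
  charP_of_injective_algebraMap (IsFractionRing.injective (MvPowerSeries (Fin n) k) K) p

theorem algebraMap_top_injective (k : Type*) [Field k] (n : ℕ) (K L : Type*) [Field K]
    [Algebra (MvPowerSeries (Fin n) k) K] [IsFractionRing (MvPowerSeries (Fin n) k) K] [Field L]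
    [Algebra K L] [Algebra (MvPowerSeries (Fin n) k) L] [IsScalarTower (MvPowerSeries (Fin n) k) K L] :
    Function.Injective (algebraMap (MvPowerSeries (Fin n) k) L) := by
  rw [IsScalarTower.algebraMap_eq (MvPowerSeries (Fin n) k) K L]
  exact (algebraMap K L).injective.comp (IsFractionRing.injective (MvPowerSeries (Fin n) k) K)

theorem charP_top (k : Type*) [Field k] (n p : ℕ) [CharP k p] [Fact p.Prime] (K L : Type*) [Field K]
    [Algebra (MvPowerSeries (Fin n) k) K] [IsFractionRing (MvPowerSeries (Fin n) k) K] [Field L]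
    [Algebra K L] [Algebra (MvPowerSeries (Fin n) k) L] [IsScalarTower (MvPowerSeries (Fin n) k) K L] :
    CharP L p :=
  charP_of_injective_algebraMap (algebraMap_top_injective k n K L) p

variable {k : Type*} [Field k] {n p : ℕ} {a : Fin n → MvPowerSeries (Fin n) k}
  {μ : MvPowerSeries (Fin n) k} [hp : Fact p.Prime] [CharP k p]

section
variable {K : Type*} [Field K] [Algebra (MvPowerSeries (Fin n) k) K]
  [IsFractionRing (MvPowerSeries (Fin n) k) K]
  {L : Type*} [Field L] [Algebra K L] [Algebra (MvPowerSeries (Fin n) k) L]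
  [IsScalarTower (MvPowerSeries (Fin n) k) K L]

theorem apply_u_of_apply_div {φ : Tower p a μ →ₐ[MvPowerSeries (Fin n) k] L} {i : Fin n}
    (h0 : algebraMap (MvPowerSeries (Fin n) k) L (μ * a i) ≠ 0) {σ : L ≃ₐ[K] L} {j : ZMod p}
    (h : σ (φ (u p a μ i) / algebraMap _ L (μ * a i)) =
      φ (u p a μ i) / algebraMap _ L (μ * a i) + j.cast) :
    σ (φ (u p a μ i)) = φ (u p a μ i) + j.cast * algebraMap (MvPowerSeries (Fin n) k) L (μ * a i) := by
  have hc : σ (algebraMap (MvPowerSeries (Fin n) k) L (μ * a i)) = algebraMap _ L (μ * a i) := by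
    rw [IsScalarTower.algebraMap_apply (MvPowerSeries (Fin n) k) K L, σ.commutes]
  rw [map_div₀, hc] at h
  generalize algebraMap (MvPowerSeries (Fin n) k) L (μ * a i) = c at *
  field_simp at h
  rw [h, mul_comm c]

-- Only an algebra map from `A` to a Galois extension `L` is needed, so this applies to the
-- separable closure before `A` is known to be a domain.
variable (K) in
theorem exists_algEquiv_translate [IsGalois K L] (φ : Tower p a μ →ₐ[MvPowerSeries (Fin n) k] L)
    (ha0 : ∀ i, a i ≠ 0) (ha : ∀ i, a i ∈ IsLocalRing.maximalIdeal (MvPowerSeries (Fin n) k))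
    (hμ : μ ≠ 0) (ν : Fin n → ZMod p) :
    ∃ σ : L ≃ₐ[K] L, ∀ i, σ (φ (u p a μ i)) =
      φ (u p a μ i) + (ν i).cast * algebraMap (MvPowerSeries (Fin n) k) L (μ * a i) := by
  have := charP_base k n p K
  have := charP_top k n p K L
  have := MvPowerSeries.isDomain_of_field (k := k) (Fin n)
  obtain ⟨σ, hσ⟩ := ArtinSchreier.exists_algEquiv_apply_eq_add (normalized_root (K := K) φ ha0 hμ)
    (pow_sub_ne_sum ha0 ha hμ) ν
  exact ⟨σ, fun i => apply_u_of_apply_div ((map_ne_zero_iff _ (algebraMap_top_injective k n K L)).2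
    (mul_ne_zero hμ (ha0 i))) (hσ i)⟩

theorem exists_degreeOf_lt_aeval_u (y : Tower p a μ) :
    ∃ P : MvPolynomial (Fin n) (MvPowerSeries (Fin n) k), (∀ i, P.degreeOf i < p) ∧
      MvPolynomial.aeval (u p a μ) P = y := by
  refine MvPolynomial.exists_degreeOf_lt_aeval_eq hp.out.one_lt
    (fun i => ⟨(μ * a i) ^ (p - 1), MvPowerSeries.X i, ?_⟩) (by rw [adjoin_range_u]; trivial)
  rw [u_pow, Algebra.smul_def]

-- If `φ` kills a polynomial in the `u_i` of degrees less than `p`, applying the translations shows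
-- that it vanishes on the whole grid of conjugates.
variable (K) in
theorem algHom_injective [IsGalois K L] (φ : Tower p a μ →ₐ[MvPowerSeries (Fin n) k] L)
    (ha0 : ∀ i, a i ≠ 0) (ha : ∀ i, a i ∈ IsLocalRing.maximalIdeal (MvPowerSeries (Fin n) k))
    (hμ : μ ≠ 0) : Function.Injective φ := by
  have := charP_base k n p K
  have := charP_top k n p K L
  have := MvPowerSeries.isDomain_of_field (k := k) (Fin n)
  have hinj := algebraMap_top_injective k n K L
  rw [injective_iff_map_eq_zero]
  intro y hy
  obtain ⟨P, hP, rfl⟩ := exists_degreeOf_lt_aeval_u y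
  have h1 : MvPolynomial.map (algebraMap (MvPowerSeries (Fin n) k) L) P = MvPolynomial.C 0 := by
    refine MvPolynomial.eq_C_of_eval_translate_eq (p := p) (w := fun i => φ (u p a μ i))
      (c := fun i => algebraMap _ L (μ * a i))
      (fun i => (map_ne_zero_iff _ hinj).2 (mul_ne_zero hμ (ha0 i)))
      (fun i => (MvPolynomial.degreeOf_map_le _ _ _).trans_lt (hP i)) fun ν => ?_
    obtain ⟨σ, hσ⟩ := exists_algEquiv_translate K φ ha0 ha hμ ν
    rw [MvPolynomial.eval_map, ← MvPolynomial.aeval_def]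
    have h2 : (fun i => φ (u p a μ i) + (ν i).cast * algebraMap (MvPowerSeries (Fin n) k) L (μ * a i)) =
      fun i => ((σ.toAlgHom.restrictScalars (MvPowerSeries (Fin n) k)).comp φ) (u p a μ i) :=
      funext fun i => (hσ i).symm
    rw [h2, ← MvPolynomial.comp_aeval_apply, AlgHom.comp_apply, hy, map_zero]
  have h2 : P = 0 := MvPolynomial.map_injective _ hinj (by rw [h1]; simp)
  rw [h2, map_zero]

theorem isGalois_and_exists_mulEquiv [Algebra (Tower p a μ) L] [IsFractionRing (Tower p a μ) L]
    [IsScalarTower (MvPowerSeries (Fin n) k) (Tower p a μ) L]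
    (ha0 : ∀ i, a i ≠ 0) (ha : ∀ i, a i ∈ IsLocalRing.maximalIdeal (MvPowerSeries (Fin n) k))
    (hμ : μ ≠ 0) : IsGalois K L ∧ ∃ Φ : Multiplicative (Fin n → ZMod p) ≃* (L ≃ₐ[K] L),
      ∀ (ν : Fin n → ZMod p) (j : Fin n),
        Φ (Multiplicative.ofAdd ν) (algebraMap (Tower p a μ) L (u p a μ j)) =
          algebraMap (Tower p a μ) L (u p a μ j) + algebraMap (MvPowerSeries (Fin n) k) L
            (((ν j).cast : MvPowerSeries (Fin n) k) * (μ * a j)) := by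
  have := charP_base k n p K
  have := charP_top k n p K L
  have := MvPowerSeries.isDomain_of_field (k := k) (Fin n)
  have hinj := algebraMap_top_injective k n K L
  have h0 : ∀ i, algebraMap (MvPowerSeries (Fin n) k) L (μ * a i) ≠ 0 :=
    fun i => (map_ne_zero_iff _ hinj).2 (mul_ne_zero hμ (ha0 i))
  set φ := IsScalarTower.toAlgHom (MvPowerSeries (Fin n) k) (Tower p a μ) L with hφ
  have hroot := normalized_root (K := K) φ ha0 hμ
  -- The normalized roots generate `L`, since `u_i` is `μ a_i` times the `i`-th one and `L` is the
  -- fraction field of `A`.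
  have htop : IntermediateField.adjoin K
      (Set.range fun i => φ (u p a μ i) / algebraMap _ L (μ * a i)) = ⊤ := by
    set E := IntermediateField.adjoin K (Set.range fun i => φ (u p a μ i) / algebraMap _ L (μ * a i))
    have hR : ∀ r, algebraMap (MvPowerSeries (Fin n) k) L r ∈ E := fun r => by
      rw [IsScalarTower.algebraMap_apply (MvPowerSeries (Fin n) k) K L]
      exact E.algebraMap_mem _
    have hA : ∀ y : Tower p a μ, algebraMap (Tower p a μ) L y ∈ E := by
      intro y
      have hy : y ∈ Algebra.adjoin (MvPowerSeries (Fin n) k) (Set.range (u p a μ)) := by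
        rw [adjoin_range_u]; trivial
      induction hy using Algebra.adjoin_induction with
      | mem x hx =>
        obtain ⟨i, rfl⟩ := hx
        have h1 : φ (u p a μ i) / algebraMap _ L (μ * a i) ∈ E :=
          IntermediateField.subset_adjoin _ _ ⟨i, rfl⟩
        have h2 := E.mul_mem h1 (hR (μ * a i))
        rwa [div_mul_cancel₀ _ (h0 i)] at h2
      | algebraMap r => rw [← IsScalarTower.algebraMap_apply]; exact hR r
      | add x y _ _ hx hy => rw [map_add]; exact E.add_mem hx hy
      | mul x y _ _ hx hy => rw [map_mul]; exact E.mul_mem hx hy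
    rw [eq_top_iff]
    rintro x -
    obtain ⟨b, c, -, rfl⟩ := IsFractionRing.div_surjective (A := Tower p a μ) x
    exact E.div_mem (hA b) (hA c)
  refine ⟨ArtinSchreier.isGalois_of_adjoin_eq_top hroot htop, ?_⟩
  obtain ⟨Φ, hΦ⟩ := ArtinSchreier.exists_mulEquiv hroot (pow_sub_ne_sum ha0 ha hμ) htop
  refine ⟨Φ, fun ν j => ?_⟩
  rw [map_mul, ArtinSchreier.map_cast]
  exact apply_u_of_apply_div (φ := φ) (h0 j) (hΦ ν j)
end

theorem isDomain_tower (ha0 : ∀ i, a i ≠ 0)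
    (ha : ∀ i, a i ∈ IsLocalRing.maximalIdeal (MvPowerSeries (Fin n) k)) (hμ : μ ≠ 0) :
    IsDomain (Tower p a μ) := by
  have := MvPowerSeries.isDomain_of_field (k := k) (Fin n)
  let R := MvPowerSeries (Fin n) k
  let K := FractionRing R
  let L := SeparableClosure K
  let _ : Algebra R L := ((algebraMap K L).comp (algebraMap R K)).toAlgebra
  have : IsScalarTower R K L := IsScalarTower.of_algebraMap_eq fun _ => rfl
  have := charP_base k n p K
  have := charP_top k n p K L
  have hinj := algebraMap_top_injective k n K L
  have hw : ∀ i, ∃ w : L, w ^ p - w = algebraMap K L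
      (algebraMap R K (MvPowerSeries.X i) / algebraMap R K (μ * a i) ^ p) := by
    intro i
    set b : L := algebraMap K L
      (algebraMap R K (MvPowerSeries.X i) / algebraMap R K (μ * a i) ^ p)
    have hdeg : (Polynomial.X ^ p - Polynomial.X - Polynomial.C b).degree ≠ 0 := by
      have h1 : (Polynomial.X + Polynomial.C b).degree < (Polynomial.X ^ p : Polynomial L).degree := by
        rw [Polynomial.degree_X_add_C, Polynomial.degree_X_pow]
        exact_mod_cast hp.out.one_lt
      rw [sub_sub, Polynomial.degree_sub_eq_left_of_degree_lt h1, Polynomial.degree_X_pow]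
      exact_mod_cast hp.out.ne_zero
    have hsep : (Polynomial.X ^ p - Polynomial.X - Polynomial.C b).Separable := by
      rw [Polynomial.separable_def]
      have : Polynomial.derivative (Polynomial.X ^ p - Polynomial.X - Polynomial.C b) = -1 := by
        simp [Polynomial.derivative_X_pow]
      rw [this]
      exact isCoprime_one_right.neg_right
    obtain ⟨w, hw⟩ := IsSepClosed.exists_root _ hdeg hsep
    refine ⟨w, ?_⟩
    simpa [Polynomial.IsRoot, sub_eq_zero] using hw
  choose w hw using hw
  obtain ⟨φ, -⟩ := exists_algHom (p := p) (a := a) (μ := μ) (D := L)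
    (fun i => algebraMap R L (μ * a i) * w i) (fun i => by
      have h0 : algebraMap R L (μ * a i) ≠ 0 :=
        (map_ne_zero_iff _ hinj).2 (mul_ne_zero hμ (ha0 i))
      have h1 := hw i
      rw [map_div₀, map_pow, ← IsScalarTower.algebraMap_apply R K L,
        ← IsScalarTower.algebraMap_apply R K L] at h1
      change _ = algebraMap R L _ * _ + algebraMap R L _
      rw [map_pow]
      generalize algebraMap R L (μ * a i) = c at *
      have hcp : c ^ (p - 1) * c = c ^ p := by
        rw [← pow_succ, Nat.sub_add_cancel hp.out.one_le]
      rw [mul_pow, ← mul_assoc, hcp, sub_eq_iff_eq_add'.1 h1, mul_add,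
        mul_div_cancel₀ _ (pow_ne_zero p h0)])
  exact (algHom_injective K φ ha0 ha hμ).isDomain φ.toRingHom
end ArtinSchreierTower
end

/-! ### The invariants of `H_s` are generated by `z_s`. -/

section

/-- The reduced denominator of the fraction `g i₀ / d i₀` divides every `d i` with `i ∈ T`, hence is
a unit. -/
theorem dvd_of_forall_mul_eq_mul {R ι : Type*} [CommRing R] [IsDomain R] [UniqueFactorizationMonoid R]
    {T : Finset ι} {d g : ι → R} {i₀ : ι} (h0 : d i₀ ≠ 0)
    (h : ∀ i ∈ T, d i₀ * g i = d i * g i₀) (hd : ∀ q, Prime q → ∃ i ∈ T, ¬ q ∣ d i) :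
    d i₀ ∣ g i₀ := by
  obtain ⟨x, y, c, hxy, hx, hy⟩ := UniqueFactorizationMonoid.exists_reduced_factors (d i₀) h0 (g i₀)
  have hc : c ≠ 0 := by
    rintro rfl
    exact h0 (by rw [← hx, zero_mul])
  have hdvd : ∀ i ∈ T, x ∣ d i := by
    intro i hi
    have h1 : x * g i = d i * y := by
      apply mul_left_cancel₀ hc
      rw [← mul_assoc, hx, h i hi, ← hy]; ring
    exact hxy.dvd_of_dvd_mul_right ⟨g i, h1.symm⟩
  have hu : IsUnit x := by
    by_contra hu
    have hx0 : x ≠ 0 := by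
      rintro rfl
      exact h0 (by rw [← hx, mul_zero])
    obtain ⟨q, hq, hqx⟩ := WfDvdMonoid.exists_irreducible_factor hu hx0
    obtain ⟨i, hi, hqi⟩ := hd q hq.prime
    exact hqi (hqx.trans (hdvd i hi))
  rw [← hx, ← hy]
  exact mul_dvd_mul_left c hu.dvd

namespace ArtinSchreierTower
variable {k : Type*} [Field k] {n p : ℕ} {a : Fin n → MvPowerSeries (Fin n) k}
  {μ : MvPowerSeries (Fin n) k}

/-- A prime dividing every `α_i` divides some `a_j`, and then, since it divides `α_j`, some `a_l`
with `l ≠ j`. -/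
theorem exists_not_dvd_alphaDiv_pow (haa : ∀ i j, i ≠ j → IsRelPrime (a i) (a j))
    {s : Fin n → ZMod p} (hs : s ≠ 0) (N : Fin n → ℕ) {q : MvPowerSeries (Fin n) k} (hq : Prime q) :
    ∃ i ∈ supp s, ¬ q ∣ alphaDiv a s i ^ N i := by
  by_contra! h
  have h1 : ∀ i ∈ supp s, ∃ j ∈ supp s, j ≠ i ∧ q ∣ a j := by
    intro i hi
    obtain ⟨j, hj, hqj⟩ := (hq.dvd_finsetProd_iff _).1 (hq.dvd_of_dvd_pow (h i hi))
    exact ⟨j, Finset.mem_of_mem_erase hj, Finset.ne_of_mem_erase hj, hqj⟩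
  obtain ⟨i, hi⟩ := supp_nonempty hs
  obtain ⟨j, hj, -, hqj⟩ := h1 i hi
  obtain ⟨l, -, hlj, hql⟩ := h1 j hj
  exact hq.not_isUnit (haa l j hlj hql hqj)

variable [hp : Fact p.Prime]

theorem f_eq (s : Fin n → ZMod p) : f a μ s = Polynomial.X ^ p -
    (Polynomial.C ((μ * alpha a s) ^ (p - 1)) * Polynomial.X + Polynomial.C (∑ i ∈ supp s,
        ((s i).cast : MvPowerSeries (Fin n) k) * alphaDiv a s i ^ p * MvPowerSeries.X i)) := by
  rw [f, sub_sub]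

theorem degree_aux (c r : MvPowerSeries (Fin n) k) :
    (Polynomial.C c * Polynomial.X + Polynomial.C r).degree < (p : WithBot ℕ) :=
  lt_of_le_of_lt Polynomial.degree_linear_le (by exact_mod_cast hp.out.one_lt)

theorem f_monic (s : Fin n → ZMod p) : (f a μ s).Monic := by
  rw [f_eq]
  exact Polynomial.monic_X_pow_sub (degree_aux _ _)

theorem f_degree (s : Fin n → ZMod p) : (f a μ s).degree = p := by
  rw [f_eq, Polynomial.degree_sub_eq_left_of_degree_lt] <;> rw [Polynomial.degree_X_pow]
  exact degree_aux _ _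

variable [CharP k p]

/-- Frobenius is additive and fixes each `s_i`; the linear terms match because `α_i ^ p (μ a_i) ^ (p
- 1) = (μ α) ^ (p - 1) α_i`. -/
theorem sum_alphaDiv_mul_pow {D : Type*} [CommRing D] [CharP D p] [Algebra (MvPowerSeries (Fin n) k) D]
    {v : Fin n → D} (hv : ∀ i, v i ^ p = algebraMap _ D ((μ * a i) ^ (p - 1)) * v i +
      algebraMap (MvPowerSeries (Fin n) k) D (MvPowerSeries.X i)) (s : Fin n → ZMod p) :
    (∑ i ∈ supp s, algebraMap (MvPowerSeries (Fin n) k) D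
      (((s i).cast : MvPowerSeries (Fin n) k) * alphaDiv a s i) * v i) ^ p =
    algebraMap _ D ((μ * alpha a s) ^ (p - 1)) * (∑ i ∈ supp s, algebraMap (MvPowerSeries (Fin n) k) D
      (((s i).cast : MvPowerSeries (Fin n) k) * alphaDiv a s i) * v i) +
    algebraMap _ D (∑ i ∈ supp s,
        ((s i).cast : MvPowerSeries (Fin n) k) * alphaDiv a s i ^ p * MvPowerSeries.X i) := by
  rw [sum_pow_char, Finset.mul_sum, map_sum, ← Finset.sum_add_distrib]
  refine Finset.sum_congr rfl fun i hi => ?_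
  rw [mul_pow, hv, ← map_pow, mul_pow, ArtinSchreier.cast_pow_p, mul_add, map_mul _ _ (MvPowerSeries.X i)]
  congr 1
  rw [← mul_assoc, ← mul_assoc, ← map_mul, ← map_mul]
  congr 2
  rw [alpha_eq_mul_alphaDiv hi]
  have : alphaDiv a s i ^ p = alphaDiv a s i ^ (p - 1) * alphaDiv a s i := by
    rw [← pow_succ, Nat.sub_add_cancel hp.out.one_le]
  rw [this, mul_pow, mul_pow, mul_pow]
  ring

theorem aeval_z_f (s : Fin n → ZMod p)
    (hinj : Function.Injective (algebraMap (MvPowerSeries (Fin n) k) (Tower p a μ))) :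
    Polynomial.aeval (z a μ s) (f a μ s) = 0 := by
  have : CharP (Tower p a μ) p := charP_of_injective_algebraMap hinj p
  rw [f_eq]
  simp only [map_sub, map_add, map_mul, Polynomial.aeval_X_pow, Polynomial.aeval_X, Polynomial.aeval_C]
  rw [sub_eq_zero]
  exact sum_alphaDiv_mul_pow u_pow s

theorem exists_degree_lt_of_mem_adjoin (s : Fin n → ZMod p)
    (hinj : Function.Injective (algebraMap (MvPowerSeries (Fin n) k) (Tower p a μ))) {y : Tower p a μ}
    (hy : y ∈ Algebra.adjoin (MvPowerSeries (Fin n) k) {z a μ s}) :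
    ∃ g : Polynomial (MvPowerSeries (Fin n) k), g.degree < p ∧ Polynomial.aeval (z a μ s) g = y := by
  rw [Algebra.adjoin_singleton_eq_range_aeval] at hy
  obtain ⟨g, rfl⟩ := hy
  refine ⟨g %ₘ f a μ s, ?_, ?_⟩
  · rw [← f_degree (a := a) (μ := μ) s]
    exact Polynomial.degree_modByMonic_lt _ (f_monic s)
  · exact Polynomial.aeval_modByMonic_eq_self_of_root (aeval_z_f s hinj)

/-- After multiplication by a power of `α_i`, the variable `u_i` can be replaced by `z_s`. -/
theorem exists_pow_mul_mem_adjoin {s : Fin n → ZMod p} {i : Fin n} (hi : i ∈ supp s) (y : Tower p a μ) :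
    ∃ N : ℕ, algebraMap (MvPowerSeries (Fin n) k) (Tower p a μ) (alphaDiv a s i ^ N) * y ∈
      Algebra.adjoin (Algebra.adjoin (MvPowerSeries (Fin n) k) {z a μ s})
        (Set.range fun j : {j // j ≠ i} => u p a μ j) := by
  set S := Algebra.adjoin (Algebra.adjoin (MvPowerSeries (Fin n) k) {z a μ s})
        (Set.range fun j : {j // j ≠ i} => u p a μ j) with hS
  have hR : ∀ r, algebraMap (MvPowerSeries (Fin n) k) (Tower p a μ) r ∈ S := fun r =>
    S.algebraMap_mem ⟨_, Subalgebra.algebraMap_mem _ r⟩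
  have hz : z a μ s ∈ S := S.algebraMap_mem ⟨_, Algebra.self_mem_adjoin_singleton _ _⟩
  have hu : ∀ j, j ≠ i → u p a μ j ∈ S := fun j hj => Algebra.subset_adjoin ⟨⟨j, hj⟩, rfl⟩
  have hy : y ∈ Algebra.adjoin (MvPowerSeries (Fin n) k) (Set.range (u p a μ)) := by
    rw [adjoin_range_u]; trivial
  induction hy using Algebra.adjoin_induction with
  | mem x hx =>
    obtain ⟨j, rfl⟩ := hx
    by_cases hj : j = i
    · subst hj
      refine ⟨1, ?_⟩
      have h1 : z a μ s - ∑ l ∈ (supp s).erase j, algebraMap (MvPowerSeries (Fin n) k) (Tower p a μ)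
          (((s l).cast : MvPowerSeries (Fin n) k) * alphaDiv a s l) * u p a μ l =
          algebraMap (MvPowerSeries (Fin n) k) (Tower p a μ)
          (((s j).cast : MvPowerSeries (Fin n) k) * alphaDiv a s j) * u p a μ j := by
        rw [z, ← Finset.add_sum_erase _ _ hi]; ring
      have h2 : ((s j)⁻¹.cast : MvPowerSeries (Fin n) k) * (s j).cast = 1 := by
        have := (ZMod.castHom (dvd_refl p) (MvPowerSeries (Fin n) k)).map_mul (s j)⁻¹ (s j)
        rw [inv_mul_cancel₀ (Finset.mem_filter.1 hi).2, map_one] at this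
        exact this.symm
      have h3 : algebraMap (MvPowerSeries (Fin n) k) (Tower p a μ) (alphaDiv a s j ^ 1) * u p a μ j =
          algebraMap (MvPowerSeries (Fin n) k) (Tower p a μ) (s j)⁻¹.cast *
            (algebraMap (MvPowerSeries (Fin n) k) (Tower p a μ)
          (((s j).cast : MvPowerSeries (Fin n) k) * alphaDiv a s j) * u p a μ j) := by
        rw [← mul_assoc, ← map_mul, ← mul_assoc, h2, one_mul, pow_one]
      rw [h3, ← h1]
      exact S.mul_mem (hR _) (S.sub_mem hz (S.sum_mem fun l hl =>
        S.mul_mem (hR _) (hu l (Finset.ne_of_mem_erase hl))))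
    · exact ⟨0, S.mul_mem (hR _) (hu j hj)⟩
  | algebraMap r => exact ⟨0, S.mul_mem (hR _) (hR _)⟩
  | add x y _ _ hx hy =>
    obtain ⟨N, hN⟩ := hx
    obtain ⟨M, hM⟩ := hy
    refine ⟨N + M, ?_⟩
    have := S.add_mem (S.mul_mem (hR (alphaDiv a s i ^ M)) hN) (S.mul_mem (hR (alphaDiv a s i ^ N)) hM)
    rw [← mul_assoc, ← mul_assoc, ← map_mul, ← map_mul, ← pow_add, ← pow_add, add_comm M N,
      ← mul_add] at this
    exact this
  | mul x y _ _ hx hy =>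
    obtain ⟨N, hN⟩ := hx
    obtain ⟨M, hM⟩ := hy
    refine ⟨N + M, ?_⟩
    have := S.mul_mem hN hM
    rw [mul_mul_mul_comm, ← map_mul, ← pow_add] at this
    exact this

section
variable {K : Type*} [Field K] [Algebra (MvPowerSeries (Fin n) k) K]
  [IsFractionRing (MvPowerSeries (Fin n) k) K]
  {L : Type*} [Field L] [Algebra K L] [Algebra (MvPowerSeries (Fin n) k) L]
  [IsScalarTower (MvPowerSeries (Fin n) k) K L]
  [Algebra (Tower p a μ) L] [IsFractionRing (Tower p a μ) L]
  [IsScalarTower (MvPowerSeries (Fin n) k) (Tower p a μ) L]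

/-- `Φ` is the identification of `(ℤ/p)^n` with the Galois group by translations of the `u_j`. -/
def IsTranslation (a : Fin n → MvPowerSeries (Fin n) k) (μ : MvPowerSeries (Fin n) k)
    [Algebra (Tower p a μ) L]
    (Φ : Multiplicative (Fin n → ZMod p) ≃* (L ≃ₐ[K] L)) : Prop :=
  ∀ (ν : Fin n → ZMod p) (j : Fin n),
    Φ (Multiplicative.ofAdd ν) (algebraMap (Tower p a μ) L (u p a μ j)) =
      algebraMap (Tower p a μ) L (u p a μ j) + algebraMap (MvPowerSeries (Fin n) k) L
        (((ν j).cast : MvPowerSeries (Fin n) k) * (μ * a j))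

variable {Φ : Multiplicative (Fin n → ZMod p) ≃* (L ≃ₐ[K] L)}

theorem apply_algebraMap_base {K L : Type*} [Field K] [Algebra (MvPowerSeries (Fin n) k) K]
    [Field L] [Algebra K L] [Algebra (MvPowerSeries (Fin n) k) L]
    [IsScalarTower (MvPowerSeries (Fin n) k) K L] (σ : L ≃ₐ[K] L) (r : MvPowerSeries (Fin n) k) :
    σ (algebraMap _ L r) = algebraMap _ L r := by
  rw [IsScalarTower.algebraMap_apply (MvPowerSeries (Fin n) k) K L, σ.commutes]

theorem IsTranslation.apply_z (hΦ : IsTranslation a μ Φ) (s ν : Fin n → ZMod p) :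
    Φ (Multiplicative.ofAdd ν) (algebraMap (Tower p a μ) L (z a μ s)) =
      algebraMap (Tower p a μ) L (z a μ s + algebraMap (MvPowerSeries (Fin n) k) (Tower p a μ)
        (((∑ i, ν i * s i : ZMod p).cast : MvPowerSeries (Fin n) k) * (μ * alpha a s))) := by
  have hcast : ((∑ i, ν i * s i : ZMod p).cast : MvPowerSeries (Fin n) k) =
      ∑ i ∈ supp s, (ν i).cast * (s i).cast := by
    rw [← Finset.sum_subset (Finset.subset_univ (supp s))]
    · have := map_sum (ZMod.castHom (dvd_refl p) (MvPowerSeries (Fin n) k)) (fun i => ν i * s i) (supp s)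
      simp only [map_mul, ZMod.castHom_apply] at this
      exact this
    · intro i _ hi
      have : s i = 0 := by
        by_contra h
        exact hi (Finset.mem_filter.2 ⟨Finset.mem_univ i, h⟩)
      rw [this, mul_zero]
  have key : ∀ (r : MvPowerSeries (Fin n) k) (i : Fin n), Φ (Multiplicative.ofAdd ν)
      (algebraMap (Tower p a μ) L (algebraMap (MvPowerSeries (Fin n) k) (Tower p a μ) r * u p a μ i)) =
      algebraMap (Tower p a μ) L (algebraMap (MvPowerSeries (Fin n) k) (Tower p a μ) r * u p a μ i +
        algebraMap (MvPowerSeries (Fin n) k) (Tower p a μ) (r * ((ν i).cast * (μ * a i)))) := by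
    intro r i
    rw [map_mul (algebraMap (Tower p a μ) L), map_mul, hΦ, ← IsScalarTower.algebraMap_apply,
      apply_algebraMap_base, map_add, map_mul (algebraMap (Tower p a μ) L),
      ← IsScalarTower.algebraMap_apply, ← IsScalarTower.algebraMap_apply, mul_add,
      map_mul _ r (_ * (_ * _))]
  rw [hcast, Finset.sum_mul, map_sum, z, ← Finset.sum_add_distrib, map_sum, map_sum, map_sum]
  refine Finset.sum_congr rfl fun i hi => ?_
  rw [key]
  congr 3
  rw [alpha_eq_mul_alphaDiv hi]
  ring

theorem apply_algebraMap_aeval (σ : L ≃ₐ[K] L) (y : Tower p a μ)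
    (g : Polynomial (MvPowerSeries (Fin n) k)) :
    σ (algebraMap (Tower p a μ) L (Polynomial.aeval y g)) =
      Polynomial.aeval (σ (algebraMap (Tower p a μ) L y)) g := by
  have h := Polynomial.aeval_algHom_apply ((σ.toAlgHom.restrictScalars (MvPowerSeries (Fin n) k)).comp
    (IsScalarTower.toAlgHom (MvPowerSeries (Fin n) k) (Tower p a μ) L)) y g
  exact h.symm

theorem IsTranslation.apply_aeval_z (hΦ : IsTranslation a μ Φ) (s ν : Fin n → ZMod p)
    (g : Polynomial (MvPowerSeries (Fin n) k)) :
    Φ (Multiplicative.ofAdd ν) (algebraMap (Tower p a μ) L (Polynomial.aeval (z a μ s) g)) =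
      algebraMap (Tower p a μ) L (Polynomial.aeval (z a μ s +
        algebraMap (MvPowerSeries (Fin n) k) (Tower p a μ)
        (((∑ i, ν i * s i : ZMod p).cast : MvPowerSeries (Fin n) k) * (μ * alpha a s))) g) := by
  rw [apply_algebraMap_aeval, hΦ.apply_z, Polynomial.aeval_algebraMap_apply]

theorem alpha_ne_zero (ha0 : ∀ i, a i ≠ 0) (s : Fin n → ZMod p) : alpha a s ≠ 0 :=
  have := MvPowerSeries.isDomain_of_field (k := k) (Fin n)
  Finset.prod_ne_zero_iff.2 fun j _ => ha0 j

theorem alphaDiv_ne_zero (ha0 : ∀ i, a i ≠ 0) (s : Fin n → ZMod p) (i : Fin n) : alphaDiv a s i ≠ 0 :=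
  have := MvPowerSeries.isDomain_of_field (k := k) (Fin n)
  Finset.prod_ne_zero_iff.2 fun j _ => ha0 j

/-- `z_s` has the `p` distinct conjugates `z_s + j μ α`, all of them roots of `g`. -/
theorem IsTranslation.eq_zero_of_aeval_z_eq_zero (hΦ : IsTranslation a μ Φ) (ha0 : ∀ i, a i ≠ 0)
    (hμ : μ ≠ 0) {s : Fin n → ZMod p} (hs : s ≠ 0) {g : Polynomial (MvPowerSeries (Fin n) k)}
    (hg : g.degree < p) (h : Polynomial.aeval (z a μ s) g = 0) : g = 0 := by
  have := charP_top k n p K L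
  have := MvPowerSeries.isDomain_of_field (k := k) (Fin n)
  have hinj := algebraMap_top_injective k n K L
  obtain ⟨i, hi⟩ := supp_nonempty hs
  have hsi : s i ≠ 0 := (Finset.mem_filter.1 hi).2
  set d := algebraMap (MvPowerSeries (Fin n) k) L (μ * alpha a s) with hd
  have hd0 : d ≠ 0 := (map_ne_zero_iff _ hinj).2 (mul_ne_zero hμ (alpha_ne_zero ha0 s))
  have hroot : ∀ j : ZMod p, (g.map (algebraMap (MvPowerSeries (Fin n) k) L)).eval
      (algebraMap (Tower p a μ) L (z a μ s) + j.cast * d) = 0 := by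
    intro j
    have h1 := hΦ.apply_aeval_z s (Pi.single i (j / s i)) g
    have h2 : ∑ l, (Pi.single i (j / s i) : Fin n → ZMod p) l * s l = j := by
      rw [Finset.sum_eq_single i]
      · rw [Pi.single_eq_same, div_mul_cancel₀ _ hsi]
      · intro l _ hl; rw [Pi.single_eq_of_ne hl, zero_mul]
      · simp
    rw [h, map_zero, map_zero, h2, ← Polynomial.aeval_algebraMap_apply, map_add,
      ← IsScalarTower.algebraMap_apply, map_mul, ArtinSchreier.map_cast] at h1
    rw [Polynomial.eval_map_algebraMap]
    exact h1.symm
  have h3 : g.map (algebraMap (MvPowerSeries (Fin n) k) L) = 0 := by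
    refine Polynomial.eq_zero_of_natDegree_lt_card_of_eval_eq_zero _ (fun j j' hj => ?_) hroot ?_
    · exact ArtinSchreier.cast_inj (S := L) (mul_right_cancel₀ hd0 (add_left_cancel hj))
    · rw [ZMod.card]
      refine lt_of_le_of_lt Polynomial.natDegree_map_le ?_
      by_cases hg0 : g = 0
      · rw [hg0, Polynomial.natDegree_zero]; exact hp.out.pos
      · exact (Polynomial.natDegree_lt_iff_degree_lt hg0).2 hg
  exact Polynomial.map_injective _ hinj (by rw [h3, Polynomial.map_zero])

/-- `H_s` fixes `S` and translates the `u_j` with `j ≠ i` arbitrarily, so a reduced polynomial over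
`S` in these `u_j` with invariant value is constant. -/
theorem IsTranslation.mem_of_mem_adjoin (hΦ : IsTranslation a μ Φ) (ha0 : ∀ i, a i ≠ 0)
    (hμ : μ ≠ 0) {s : Fin n → ZMod p} {i : Fin n} (hsi : s i ≠ 0)
    {S : Subalgebra (MvPowerSeries (Fin n) k) (Tower p a μ)}
    (hS : ∀ ν, ∑ i, ν i * s i = 0 → ∀ c ∈ S,
      Φ (Multiplicative.ofAdd ν) (algebraMap (Tower p a μ) L c) = algebraMap (Tower p a μ) L c)
    {y : Tower p a μ} (hyS : y ∈ Algebra.adjoin S (Set.range fun j : {j // j ≠ i} => u p a μ j))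
    (hy : ∀ ν, ∑ i, ν i * s i = 0 →
      Φ (Multiplicative.ofAdd ν) (algebraMap (Tower p a μ) L y) = algebraMap (Tower p a μ) L y) :
    y ∈ S := by
  have := charP_top k n p K L
  have := MvPowerSeries.isDomain_of_field (k := k) (Fin n)
  have hinj := algebraMap_top_injective k n K L
  have hrel : ∀ j : {j // j ≠ i}, ∃ c x : S,
      u p a μ j.1 ^ p = c • u p a μ j.1 + algebraMap S (Tower p a μ) x := fun j =>
    ⟨algebraMap (MvPowerSeries (Fin n) k) S ((μ * a j) ^ (p - 1)),
      algebraMap (MvPowerSeries (Fin n) k) S (MvPowerSeries.X j.1), by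
        rw [u_pow, Algebra.smul_def]; rfl⟩
  obtain ⟨P, hP, hPy⟩ := MvPolynomial.exists_degreeOf_lt_aeval_eq hp.out.one_lt hrel hyS
  set γ : S →+* L := (algebraMap (Tower p a μ) L).comp S.val.toRingHom with hγ
  have key : MvPolynomial.map γ P = MvPolynomial.C (algebraMap (Tower p a μ) L y) := by
    refine MvPolynomial.eq_C_of_eval_translate_eq (p := p)
      (w := fun j : {j // j ≠ i} => algebraMap (Tower p a μ) L (u p a μ j.1))
      (c := fun j : {j // j ≠ i} => algebraMap _ L (μ * a j.1))
      (fun j => (map_ne_zero_iff _ hinj).2 (mul_ne_zero hμ (ha0 j)))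
      (fun j => (MvPolynomial.degreeOf_map_le _ _ _).trans_lt (hP j)) fun ν' => ?_
    -- The `i`-th coordinate is solved from `∑ ν_j s_j = 0`, using `s i ≠ 0`.
    set ν : Fin n → ZMod p := fun j =>
      if h : j ≠ i then ν' ⟨j, h⟩ else -(∑ l : {j // j ≠ i}, ν' l * s l) / s i with hν
    have hν2 : ∀ l : {j // j ≠ i}, ν l = ν' l := fun l => by simp [hν, l.2]
    have hν0 : ∑ j, ν j * s j = 0 := by
      rw [Fintype.sum_eq_add_sum_subtype_ne _ i]
      have h1 : ν i = -(∑ l : {j // j ≠ i}, ν' l * s l) / s i := by simp [hν]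
      rw [h1, div_mul_cancel₀ _ hsi]
      simp only [hν2]
      exact neg_add_cancel _
    set σ := Φ (Multiplicative.ofAdd ν) with hσ
    have hσγ : (σ : L →+* L).comp γ = γ := RingHom.ext fun c => hS ν hν0 c c.2
    have hσu : ∀ j : {j // j ≠ i}, algebraMap (Tower p a μ) L (u p a μ j.1) +
        (ν' j).cast * algebraMap (MvPowerSeries (Fin n) k) L (μ * a j.1) =
        σ (algebraMap (Tower p a μ) L (u p a μ j.1)) := fun j => by
      rw [hΦ ν j, hν2, map_mul _ _ (μ * a j.1), ArtinSchreier.map_cast]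
    rw [MvPolynomial.eval_map, ← hy ν hν0, ← hPy]
    simp only [hσu]
    have h5 := MvPolynomial.hom_eval₂ P
      (algebraMap S (Tower p a μ)) ((σ : L →+* L).comp (algebraMap (Tower p a μ) L))
      (fun j : {j // j ≠ i} => u p a μ j.1)
    refine Eq.trans ?_ h5.symm
    exact congrArg (fun γ' => MvPolynomial.eval₂ γ' _ P) hσγ.symm
  have h6 := congrArg (MvPolynomial.coeff 0) key
  rw [MvPolynomial.coeff_map, MvPolynomial.coeff_zero_C] at h6
  rw [← IsFractionRing.injective (Tower p a μ) L h6]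
  exact (MvPolynomial.coeff 0 P).2

theorem IsTranslation.exists_pow_mul_mem (hΦ : IsTranslation a μ Φ) (ha0 : ∀ i, a i ≠ 0)
    (hμ : μ ≠ 0) {s : Fin n → ZMod p} {i : Fin n} (hi : i ∈ supp s) {y : Tower p a μ}
    (hy : ∀ ν, ∑ i, ν i * s i = 0 →
      Φ (Multiplicative.ofAdd ν) (algebraMap (Tower p a μ) L y) = algebraMap (Tower p a μ) L y) :
    ∃ N : ℕ, algebraMap (MvPowerSeries (Fin n) k) (Tower p a μ) (alphaDiv a s i ^ N) * y ∈
      Algebra.adjoin (MvPowerSeries (Fin n) k) {z a μ s} := by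
  obtain ⟨N, hN⟩ := exists_pow_mul_mem_adjoin hi y
  refine ⟨N, hΦ.mem_of_mem_adjoin ha0 hμ (Finset.mem_filter.1 hi).2 (fun ν hν c hc => ?_) hN
    fun ν hν => ?_⟩
  · rw [Algebra.adjoin_singleton_eq_range_aeval] at hc
    obtain ⟨g, rfl⟩ := hc
    have := hΦ.apply_aeval_z s ν g
    rw [hν, ZMod.cast_zero, zero_mul, map_zero, add_zero] at this
    exact this
  · rw [map_mul, map_mul, hy ν hν, ← IsScalarTower.algebraMap_apply, apply_algebraMap_base]

theorem algebraMap_tower_injective (K L : Type*) [Field K] [Algebra (MvPowerSeries (Fin n) k) K]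
    [IsFractionRing (MvPowerSeries (Fin n) k) K] [Field L] [Algebra K L]
    [Algebra (MvPowerSeries (Fin n) k) L] [IsScalarTower (MvPowerSeries (Fin n) k) K L]
    [Algebra (Tower p a μ) L] [IsScalarTower (MvPowerSeries (Fin n) k) (Tower p a μ) L] :
    Function.Injective (algebraMap (MvPowerSeries (Fin n) k) (Tower p a μ)) := by
  have h := algebraMap_top_injective k n K L
  rw [IsScalarTower.algebraMap_eq (MvPowerSeries (Fin n) k) (Tower p a μ) L, RingHom.coe_comp] at h
  exact h.of_comp

theorem IsTranslation.mem_adjoin_z [IsDomain (Tower p a μ)] (hΦ : IsTranslation a μ Φ)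
    (ha0 : ∀ i, a i ≠ 0)
    (haa : ∀ i j, i ≠ j → IsRelPrime (a i) (a j))
    (hμ : μ ≠ 0) {s : Fin n → ZMod p} (hs : s ≠ 0) {y : Tower p a μ}
    (hy : ∀ ν, ∑ i, ν i * s i = 0 →
      Φ (Multiplicative.ofAdd ν) (algebraMap (Tower p a μ) L y) = algebraMap (Tower p a μ) L y) :
    y ∈ Algebra.adjoin (MvPowerSeries (Fin n) k) {z a μ s} := by
  have := MvPowerSeries.isDomain_of_field (k := k) (Fin n)
  have := MvPowerSeries.uniqueFactorizationMonoid_fin (k := k) n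
  have hinjA : Function.Injective (algebraMap (MvPowerSeries (Fin n) k) (Tower p a μ)) :=
    algebraMap_tower_injective K L
  have h1 : ∀ i, ∃ (N : ℕ) (g : Polynomial (MvPowerSeries (Fin n) k)), i ∈ supp s → g.degree < p ∧
      Polynomial.aeval (z a μ s) g =
        algebraMap (MvPowerSeries (Fin n) k) (Tower p a μ) (alphaDiv a s i ^ N) * y := by
    intro i
    by_cases hi : i ∈ supp s
    · obtain ⟨N, hN⟩ := hΦ.exists_pow_mul_mem ha0 hμ hi hy
      obtain ⟨g, hg⟩ := exists_degree_lt_of_mem_adjoin s hinjA hN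
      exact ⟨N, g, fun _ => hg⟩
    · exact ⟨0, 0, fun h => absurd h hi⟩
  choose N g hg using h1
  obtain ⟨i₀, hi₀⟩ := supp_nonempty hs
  set d : Fin n → MvPowerSeries (Fin n) k := fun i => alphaDiv a s i ^ N i with hd
  have hd0 : ∀ i, d i ≠ 0 := fun i => pow_ne_zero _ (alphaDiv_ne_zero ha0 s i)
  -- Both sides take the value `d i₀ * d i * y` at `z_s` and have degree less than `p`.
  have h2 : ∀ i ∈ supp s, Polynomial.C (d i₀) * g i = Polynomial.C (d i) * g i₀ := by
    intro i hi
    rw [← sub_eq_zero]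
    refine hΦ.eq_zero_of_aeval_z_eq_zero ha0 hμ hs ?_ ?_
    · refine lt_of_le_of_lt (Polynomial.degree_sub_le _ _) (max_lt ?_ ?_)
      · rw [Polynomial.degree_C_mul (hd0 i₀)]; exact (hg i hi).1
      · rw [Polynomial.degree_C_mul (hd0 i)]; exact (hg i₀ hi₀).1
    · rw [map_sub, map_mul, map_mul, Polynomial.aeval_C, Polynomial.aeval_C, (hg i hi).2,
        (hg i₀ hi₀).2]
      ring
  have h3 : Polynomial.C (d i₀) ∣ g i₀ := by
    rw [Polynomial.C_dvd_iff_dvd_coeff]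
    intro l
    refine dvd_of_forall_mul_eq_mul (T := supp s) (g := fun i => (g i).coeff l) (hd0 i₀) (fun i hi => ?_)
      (fun q hq => exists_not_dvd_alphaDiv_pow haa hs N hq)
    have := congrArg (fun P => Polynomial.coeff P l) (h2 i hi)
    simpa only [Polynomial.coeff_C_mul] using this
  obtain ⟨h, hh⟩ := h3
  have h4 := (hg i₀ hi₀).2
  rw [hh, map_mul, Polynomial.aeval_C] at h4
  have h5 := mul_left_cancel₀ ((map_ne_zero_iff _ hinjA).2 (hd0 i₀)) h4
  rw [← h5, Algebra.adjoin_singleton_eq_range_aeval]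
  exact ⟨h, rfl⟩
end
end ArtinSchreierTower
end

/-! ### Local structure of `R[z]/(f)`, fixed ideals and the action on the invariants. -/

section

section AdjoinRoot
variable {R : Type*} [CommRing R] [IsLocalRing R] {p : ℕ} {c r : R}

theorem AdjoinRoot.exists_residue (hp : p ≠ 0) (hr : r ∈ IsLocalRing.maximalIdeal R) :
    ∃ θ : AdjoinRoot (Polynomial.X ^ p - (Polynomial.C c * Polynomial.X + Polynomial.C r)) →+*
      IsLocalRing.ResidueField R,
      (∀ x, θ (AdjoinRoot.of _ x) = IsLocalRing.residue R x) ∧ θ (AdjoinRoot.root _) = 0 := by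
  have h : (Polynomial.X ^ p - (Polynomial.C c * Polynomial.X + Polynomial.C r)).eval₂
      (IsLocalRing.residue R) 0 = 0 := by
    simp [hp, (IsLocalRing.residue_eq_zero_iff r).2 hr]
  exact ⟨AdjoinRoot.lift _ _ h, fun x => AdjoinRoot.lift_of h, AdjoinRoot.lift_root h⟩

/-- By integrality a maximal ideal `M` lies over that of `R`. It contains the root, whose `p`-th
power is `c` times it plus `r`, so `M` is the kernel of the residue map `θ`. -/
theorem AdjoinRoot.isLocalRing_of_mem_maximalIdeal (hp : 1 < p)
    (hc : c ∈ IsLocalRing.maximalIdeal R) (hr : r ∈ IsLocalRing.maximalIdeal R) :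
    IsLocalRing (AdjoinRoot (Polynomial.X ^ p - (Polynomial.C c * Polynomial.X + Polynomial.C r))) := by
  set f := Polynomial.X ^ p - (Polynomial.C c * Polynomial.X + Polynomial.C r) with hf
  have hmon : f.Monic := by
    refine Polynomial.monic_X_pow_sub (lt_of_le_of_lt Polynomial.degree_linear_le ?_)
    exact_mod_cast hp
  obtain ⟨θ, hθ, hθr⟩ := AdjoinRoot.exists_residue (c := c) (by omega : p ≠ 0) hr
  have hθs : Function.Surjective θ := fun y => by
    obtain ⟨x, rfl⟩ := IsLocalRing.residue_surjective y
    exact ⟨_, hθ x⟩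
  have hmax : (RingHom.ker θ).IsMaximal := RingHom.ker_isMaximal_of_surjective θ hθs
  have hint : Algebra.IsIntegral R (AdjoinRoot f) := by
    have := hmon.finite_adjoinRoot
    infer_instance
  refine IsLocalRing.of_unique_max_ideal ⟨_, hmax, fun M hM => ?_⟩
  have hM' : (M.comap (algebraMap R (AdjoinRoot f))).IsMaximal :=
    Ideal.isMaximal_comap_of_isIntegral_of_isMaximal M
  have hmem : ∀ x ∈ IsLocalRing.maximalIdeal R, AdjoinRoot.of f x ∈ M := by
    intro x hx
    rw [← IsLocalRing.eq_maximalIdeal hM'] at hx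
    exact hx
  have hroot : AdjoinRoot.root f ∈ M := by
    have h0 : AdjoinRoot.mk f (Polynomial.X ^ p - (Polynomial.C c * Polynomial.X + Polynomial.C r)) = 0 :=
      AdjoinRoot.mk_self
    have h1 : AdjoinRoot.root f ^ p =
        AdjoinRoot.of f c * AdjoinRoot.root f + AdjoinRoot.of f r := by
      rw [map_sub, map_add, map_mul, map_pow, AdjoinRoot.mk_X, AdjoinRoot.mk_C, AdjoinRoot.mk_C] at h0
      exact sub_eq_zero.1 h0
    refine hM.isPrime.mem_of_pow_mem p ?_
    rw [h1]
    exact M.add_mem (M.mul_mem_right _ (hmem c hc)) (hmem r hr)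
  symm
  refine hmax.eq_of_le hM.ne_top fun x hx => ?_
  obtain ⟨g, rfl⟩ := AdjoinRoot.mk_surjective x
  rw [← g.divX_mul_X_add, map_add, map_mul, AdjoinRoot.mk_X, AdjoinRoot.mk_C] at hx ⊢
  rw [RingHom.mem_ker, map_add, map_mul, hθr, mul_zero, zero_add, hθ,
    IsLocalRing.residue_eq_zero_iff] at hx
  exact M.add_mem (M.mul_mem_left _ hroot) (hmem _ hx)
end AdjoinRoot

namespace ArtinSchreierTower

/-- As `B = R[y]`, each `σ b - b` is `g(σ y) - g(y)`, a multiple of `σ y - y = v d`. -/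
theorem fixedIdeal_eq_span_singleton {R B : Type*} [CommRing R] [CommRing B] [Algebra R B] {σ : B ≃ₐ[R] B}
    {y v d : B} (hv : IsUnit v) (hσ : σ y = y + v * d)
    (hy : ∀ b : B, ∃ g : Polynomial R, Polynomial.aeval y g = b) :
    fixedIdeal σ.toRingEquiv = Ideal.span {d} := by
  apply le_antisymm
  · rw [fixedIdeal, Ideal.span_le]
    rintro _ ⟨b, rfl⟩
    obtain ⟨g, rfl⟩ := hy b
    have h1 : σ (Polynomial.aeval y g) = Polynomial.aeval (σ y) g :=
      (Polynomial.aeval_algHom_apply σ y g).symm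
    have h2 := Polynomial.sub_dvd_eval_sub (σ y) y (g.map (algebraMap R B))
    rw [Polynomial.eval_map_algebraMap, Polynomial.eval_map_algebraMap, ← h1, hσ, add_sub_cancel_left] at h2
    exact Ideal.mem_span_singleton.2 ((dvd_mul_left d v).trans h2)
  · rw [Ideal.span_singleton_le_iff_mem]
    have h1 : σ y - y ∈ fixedIdeal σ.toRingEquiv := Ideal.subset_span ⟨y, rfl⟩
    rw [hσ, add_sub_cancel_left] at h1
    exact (Ideal.unit_mul_mem_iff_mem _ hv).1 h1

theorem exists_quotient_action {R A K L : Type*} [CommRing R] [CommRing A] [Algebra R A]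
    [Field K] [Field L] [Algebra A L] [Algebra K L] [Algebra R L] [Algebra R K]
    [IsScalarTower R K L] [IsScalarTower R A L] (hinj : Function.Injective (algebraMap A L))
    (S : Subalgebra R A) (N : Subgroup (L ≃ₐ[K] L)) [N.Normal]
    (hN : ∀ h ∈ N, ∀ b ∈ S, h (algebraMap A L b) = algebraMap A L b)
    (hS : ∀ (h : L ≃ₐ[K] L), ∀ b ∈ S, ∃ b' ∈ S, algebraMap A L b' = h (algebraMap A L b)) :
    ∃ ρ : ((L ≃ₐ[K] L) ⧸ N) →* (S ≃ₐ[R] S), ∀ (h : L ≃ₐ[K] L) (b : S),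
      algebraMap A L (ρ (QuotientGroup.mk h) b : A) = h (algebraMap A L (b : A)) := by
  have hS' : ∀ (h : L ≃ₐ[K] L) (b : S), ∃ b' : S, algebraMap A L b' = h (algebraMap A L (b : A)) :=
    fun h b => by
      obtain ⟨b', hb', h1⟩ := hS h b b.2
      exact ⟨⟨b', hb'⟩, h1⟩
  choose F hF using hS'
  have hext : ∀ b b' : S, algebraMap A L (b : A) = algebraMap A L (b' : A) → b = b' :=
    fun b b' h => Subtype.ext (hinj h)
  let E : (L ≃ₐ[K] L) → (S →ₐ[R] S) := fun h =>
    { toFun := F h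
      map_one' := hext _ _ (by rw [hF]; simp)
      map_mul' := fun x y => hext _ _ (by rw [hF]; simp [hF])
      map_zero' := hext _ _ (by rw [hF]; simp)
      map_add' := fun x y => hext _ _ (by rw [hF]; simp [hF])
      commutes' := fun x => hext _ _ (by
        rw [hF, Subalgebra.coe_algebraMap, ← IsScalarTower.algebraMap_apply,
          IsScalarTower.algebraMap_apply R K L, h.commutes]) }
  have hE : ∀ h b, algebraMap A L (E h b : A) = h (algebraMap A L (b : A)) := hF
  have hE1 : ∀ h h' : L ≃ₐ[K] L, h * h' = 1 → (E h).comp (E h') = AlgHom.id R S := fun h h' hh =>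
    AlgHom.ext fun b => hext _ _ (by
      rw [AlgHom.comp_apply, hE, hE, ← AlgEquiv.mul_apply, hh]; rfl)
  let G : (L ≃ₐ[K] L) →* (S ≃ₐ[R] S) := MonoidHom.mk'
    (fun h => AlgEquiv.ofAlgHom (E h) (E h⁻¹) (hE1 _ _ (mul_inv_cancel h)) (hE1 _ _ (inv_mul_cancel h)))
    (fun h h' => AlgEquiv.ext fun b => hext _ _ (by
      change algebraMap A L (E (h * h') b : A) = algebraMap A L (E h (E h' b) : A)
      rw [hE, hE, hE]; rfl))
  have hG : ∀ h b, algebraMap A L (G h b : A) = h (algebraMap A L (b : A)) := hF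
  exact ⟨QuotientGroup.lift N G fun h hh => AlgEquiv.ext fun b => hext _ _ (by
    rw [hG, hN h hh b b.2]; rfl), fun h b => hG h b⟩

section
variable {k : Type*} [Field k] {n p : ℕ} {a : Fin n → MvPowerSeries (Fin n) k}
  {μ : MvPowerSeries (Fin n) k} [hp : Fact p.Prime] [CharP k p]
  {K : Type*} [Field K] [Algebra (MvPowerSeries (Fin n) k) K]
  [IsFractionRing (MvPowerSeries (Fin n) k) K]
  {L : Type*} [Field L] [Algebra K L] [Algebra (MvPowerSeries (Fin n) k) L]
  [IsScalarTower (MvPowerSeries (Fin n) k) K L]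
  [Algebra (Tower p a μ) L] [IsFractionRing (Tower p a μ) L]
  [IsScalarTower (MvPowerSeries (Fin n) k) (Tower p a μ) L]
  {Φ : Multiplicative (Fin n → ZMod p) ≃* (L ≃ₐ[K] L)}

theorem mem_invariants_iff {s : Fin n → ZMod p} {y : Tower p a μ} :
    y ∈ invariants (MvPowerSeries (Fin n) k) (Tower p a μ) ((perp s).map Φ.toMonoidHom) ↔
      ∀ ν, ∑ i, ν i * s i = 0 →
      Φ (Multiplicative.ofAdd ν) (algebraMap (Tower p a μ) L y) = algebraMap (Tower p a μ) L y :=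
  ⟨fun h ν hν => h _ ⟨Multiplicative.ofAdd ν, hν, rfl⟩, fun h _ ⟨ν, hν, hx⟩ => hx ▸ h ν.toAdd hν⟩

theorem IsTranslation.mem_invariants_iff_mem_adjoin [IsDomain (Tower p a μ)] (hΦ : IsTranslation a μ Φ)
    (ha0 : ∀ i, a i ≠ 0) (haa : ∀ i j, i ≠ j → IsRelPrime (a i) (a j))
    (hμ : μ ≠ 0) {s : Fin n → ZMod p} (hs : s ≠ 0) {y : Tower p a μ} :
    y ∈ invariants (MvPowerSeries (Fin n) k) (Tower p a μ) ((perp s).map Φ.toMonoidHom) ↔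
      ∃ g : Polynomial (MvPowerSeries (Fin n) k), Polynomial.aeval (z a μ s) g = y := by
  rw [mem_invariants_iff]
  constructor
  · intro h
    have := hΦ.mem_adjoin_z ha0 haa hμ hs h
    rwa [Algebra.adjoin_singleton_eq_range_aeval] at this
  · rintro ⟨g, rfl⟩ ν hν
    have := hΦ.apply_aeval_z s ν g
    rwa [hν, ZMod.cast_zero, zero_mul, map_zero, add_zero] at this

theorem IsTranslation.exists_algEquiv [IsDomain (Tower p a μ)] (hΦ : IsTranslation a μ Φ)
    (ha0 : ∀ i, a i ≠ 0) (haa : ∀ i j, i ≠ j → IsRelPrime (a i) (a j))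
    (hμ : μ ≠ 0) {s : Fin n → ZMod p} (hs : s ≠ 0) :
    ∃ e : AdjoinRoot (f a μ s) ≃ₐ[MvPowerSeries (Fin n) k]
        invariants (MvPowerSeries (Fin n) k) (Tower p a μ) ((perp s).map Φ.toMonoidHom),
      (e (AdjoinRoot.root (f a μ s)) : Tower p a μ) = z a μ s := by
  have hinjA : Function.Injective (algebraMap (MvPowerSeries (Fin n) k) (Tower p a μ)) :=
    algebraMap_tower_injective K L
  have hmem := fun y => hΦ.mem_invariants_iff_mem_adjoin ha0 haa hμ hs (y := y)
  let ψ : AdjoinRoot (f a μ s) →ₐ[MvPowerSeries (Fin n) k] Tower p a μ :=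
    AdjoinRoot.liftAlgHom (f a μ s) (Algebra.ofId _ _) (z a μ s) (aeval_z_f s hinjA)
  have hψ : ∀ g, ψ (AdjoinRoot.mk _ g) = Polynomial.aeval (z a μ s) g := fun g => rfl
  have hψmem : ∀ x, ψ x ∈
      invariants (MvPowerSeries (Fin n) k) (Tower p a μ) ((perp s).map Φ.toMonoidHom) := fun x => by
    obtain ⟨g, rfl⟩ := AdjoinRoot.mk_surjective x
    exact (hmem _).2 ⟨g, (hψ g).symm⟩
  refine ⟨AlgEquiv.ofBijective (ψ.codRestrict _ hψmem) ⟨?_, ?_⟩, ?_⟩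
  · rw [injective_iff_map_eq_zero]
    intro x hx
    obtain ⟨g, rfl⟩ := AdjoinRoot.mk_surjective x
    have h1 : Polynomial.aeval (z a μ s) g = 0 := congrArg Subtype.val hx
    rw [AdjoinRoot.mk_eq_zero, ← Polynomial.modByMonic_eq_zero_iff_dvd (f_monic (a := a) (μ := μ) s)]
    refine hΦ.eq_zero_of_aeval_z_eq_zero ha0 hμ hs ?_ ?_
    · rw [← f_degree (a := a) (μ := μ) s]
      exact Polynomial.degree_modByMonic_lt _ (f_monic s)
    · rw [← h1]
      exact Polynomial.aeval_modByMonic_eq_self_of_root (aeval_z_f s hinjA)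
  · rintro ⟨y, hy⟩
    obtain ⟨g, rfl⟩ := (hmem y).1 hy
    exact ⟨AdjoinRoot.mk _ g, Subtype.ext (hψ g)⟩
  · exact AdjoinRoot.liftAlgHom_root _ _ _ (aeval_z_f s hinjA)
end

end ArtinSchreierTower

end

/-! ### Assembly of the theorem. -/

open ArtinSchreierTower

theorem mainTheorem8 {p : ℕ} [Fact p.Prime] {k : Type*} [Field k] [CharP k p]
    {n : ℕ} (hn : 2 ≤ n)
    (a : Fin n → MvPowerSeries (Fin n) k) (μ : MvPowerSeries (Fin n) k)
    (ha : ∀ i, a i ∈ IsLocalRing.maximalIdeal (MvPowerSeries (Fin n) k))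
    (haa : ∀ i j, i ≠ j → IsRelPrime (a i) (a j))
    (hμ : μ ≠ 0) (hμa : ∀ i, IsRelPrime μ (a i)) :
    -- `A` is a domain; `K` and `L` are fraction fields of `R` and `A`
    IsDomain (ArtinSchreierTower.Tower p a μ) ∧
    ∀ (K : Type*) (L : Type*) [Field K] [Field L]
      [Algebra (MvPowerSeries (Fin n) k) K] [IsFractionRing (MvPowerSeries (Fin n) k) K]
      [Algebra (ArtinSchreierTower.Tower p a μ) L]
      [IsFractionRing (ArtinSchreierTower.Tower p a μ) L]
      [Algebra K L] [Algebra (MvPowerSeries (Fin n) k) L]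
      [IsScalarTower (MvPowerSeries (Fin n) k) K L]
      [IsScalarTower (MvPowerSeries (Fin n) k) (ArtinSchreierTower.Tower p a μ) L],
      IsGalois K L ∧
      -- the identification of the Galois group with `(ℤ/p)^n`
      ∃ Φ : Multiplicative (Fin n → ZMod p) ≃* (L ≃ₐ[K] L),
        (∀ (ν : Fin n → ZMod p) (j : Fin n),
          Φ (Multiplicative.ofAdd ν) (algebraMap (ArtinSchreierTower.Tower p a μ) L (ArtinSchreierTower.u p a μ j)) =
            algebraMap (ArtinSchreierTower.Tower p a μ) L (ArtinSchreierTower.u p a μ j) +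
              algebraMap (MvPowerSeries (Fin n) k) L
                (((ν j).cast : MvPowerSeries (Fin n) k) * (μ * a j))) ∧
        -- the subgroups of order `p ^ (n - 1)` are the `H_s` with `s ≠ 0`
        (∀ H' : Subgroup (L ≃ₐ[K] L), Nat.card H' = p ^ (n - 1) ↔
          ∃ s : Fin n → ZMod p, s ≠ 0 ∧ H' = (ArtinSchreierTower.perp s).map Φ.toMonoidHom) ∧
        ∀ (s : Fin n → ZMod p), s ≠ 0 →
          ∀ Hs : Subgroup (L ≃ₐ[K] L), Hs = (ArtinSchreierTower.perp s).map Φ.toMonoidHom →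
            -- the isomorphism of `R`-algebras from `R[z]/(f(z))` to `A^{H_s}`, with `z ↦ z_s`
            (∃ e : AdjoinRoot (ArtinSchreierTower.f a μ s) ≃ₐ[MvPowerSeries (Fin n) k]
                ArtinSchreierTower.invariants (MvPowerSeries (Fin n) k)
                  (ArtinSchreierTower.Tower p a μ) Hs,
              (e (AdjoinRoot.root (ArtinSchreierTower.f a μ s)) :
                ArtinSchreierTower.Tower p a μ) = ArtinSchreierTower.z a μ s) ∧
            Module.Flat (MvPowerSeries (Fin n) k)
              (ArtinSchreierTower.invariants (MvPowerSeries (Fin n) k)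
                (ArtinSchreierTower.Tower p a μ) Hs) ∧
            -- the action of `H / H_s`: every non-trivial class is a pseudo-reflection
            ∃ _ : Hs.Normal,
              ∃ ρ : ((L ≃ₐ[K] L) ⧸ Hs) →*
                  (ArtinSchreierTower.invariants (MvPowerSeries (Fin n) k)
                      (ArtinSchreierTower.Tower p a μ) Hs ≃ₐ[MvPowerSeries (Fin n) k]
                    ArtinSchreierTower.invariants (MvPowerSeries (Fin n) k)
                      (ArtinSchreierTower.Tower p a μ) Hs),
                (∀ (h : L ≃ₐ[K] L)
                  (b : ArtinSchreierTower.invariants (MvPowerSeries (Fin n) k)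
                    (ArtinSchreierTower.Tower p a μ) Hs),
                  algebraMap (ArtinSchreierTower.Tower p a μ) L
                      (ρ (QuotientGroup.mk h) b : ArtinSchreierTower.Tower p a μ) =
                    h (algebraMap (ArtinSchreierTower.Tower p a μ) L
                      (b : ArtinSchreierTower.Tower p a μ))) ∧
                ∀ h : L ≃ₐ[K] L, h ∉ Hs →
                  ArtinSchreierTower.IsPseudoReflection (ρ (QuotientGroup.mk h)).toRingEquiv := by
  have := MvPowerSeries.isDomain_of_field (k := k) (Fin n)
  -- If `a_i = 0`, any other `a_j`, which exists as `n ≥ 2`, is a common factor of `a_i` and `a_j`,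
  -- yet not a unit.
  have ha0 : ∀ i, a i ≠ 0 := by
    intro i hi
    obtain ⟨j, hj⟩ : ∃ j : Fin n, j ≠ i :=
      have : Nontrivial (Fin n) := Fin.nontrivial_iff_two_le.2 hn
      exists_ne i
    have h1 := haa j i hj dvd_rfl (by rw [hi]; exact dvd_zero _)
    exact (IsLocalRing.mem_maximalIdeal _).1 (ha j) h1
  have hdom : IsDomain (Tower p a μ) := isDomain_tower ha0 ha hμ
  refine ⟨hdom, ?_⟩
  intro K L _ _ _ _ _ _ _ _ _ _
  obtain ⟨hgal, Φ, hΦ⟩ := isGalois_and_exists_mulEquiv (K := K) (L := L) (p := p) ha0 ha hμ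
  have hΦ' : IsTranslation a μ Φ := hΦ
  refine ⟨hgal, Φ, hΦ, fun H' => ?_, ?_⟩
  · have h1 := card_eq_iff_exists_perp (p := p) (n := n) (by omega) (H'.comap Φ.toMonoidHom)
    have hmc : (H'.comap Φ.toMonoidHom).map Φ.toMonoidHom = H' :=
      Subgroup.map_comap_eq_self_of_surjective Φ.surjective H'
    have h2 : Nat.card (H'.comap Φ.toMonoidHom) = Nat.card H' := by
      conv_rhs => rw [← hmc]
      exact (Nat.card_congr (Subgroup.equivMapOfInjective _ Φ.toMonoidHom Φ.injective).toEquiv)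
    rw [← h2, h1]
    refine exists_congr fun s => and_congr_right fun _ => ⟨fun h => by rw [← h, hmc], fun h => ?_⟩
    rw [h]
    exact Subgroup.comap_map_eq_self_of_injective Φ.injective _
  intro s hs Hs hHs
  subst hHs
  set Hs := (perp s).map Φ.toMonoidHom with hHs
  set B := invariants (MvPowerSeries (Fin n) k) (Tower p a μ) Hs with hB
  obtain ⟨e, he⟩ : ∃ e : AdjoinRoot (f a μ s) ≃ₐ[MvPowerSeries (Fin n) k] B,
      (e (AdjoinRoot.root (f a μ s)) : Tower p a μ) = z a μ s :=
    hΦ'.exists_algEquiv ha0 haa hμ hs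
  have hmem : ∀ y, y ∈ B ↔ _ := fun y => hΦ'.mem_invariants_iff_mem_adjoin ha0 haa hμ hs (y := y)
  have hinjL := IsFractionRing.injective (Tower p a μ) L
  refine ⟨⟨e, he⟩, ?_, ?_⟩
  · have := (f_monic (a := a) (μ := μ) s).free_adjoinRoot
    exact Module.Flat.of_linearEquiv e.symm.toLinearEquiv
  have hcomm : ∀ x y : L ≃ₐ[K] L, x * y = y * x := by
    intro x y
    obtain ⟨ν, rfl⟩ := Φ.surjective x
    obtain ⟨ν', rfl⟩ := Φ.surjective y
    rw [← map_mul, ← map_mul, mul_comm]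
  have hnorm : Hs.Normal := ⟨fun x hx g => by rwa [hcomm g x, mul_inv_cancel_right]⟩
  obtain ⟨ρ, hρ⟩ := exists_quotient_action hinjL B Hs (fun h hh b hb => hb h hh) (by
    intro h b hb
    obtain ⟨g, rfl⟩ := (hmem b).1 hb
    obtain ⟨ν, rfl⟩ := Φ.surjective h
    refine ⟨_, ?_, (hΦ'.apply_aeval_z s ν.toAdd g).symm⟩
    exact (hmem _).2 ⟨g.comp (Polynomial.X + Polynomial.C _), by
      rw [Polynomial.aeval_comp, map_add, Polynomial.aeval_X, Polynomial.aeval_C]⟩)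
  refine ⟨hnorm, ρ, hρ, fun h hh => ?_⟩
  obtain ⟨ν, rfl⟩ := Φ.surjective h
  have hν : ∑ i, ν.toAdd i * s i ≠ 0 := fun h0 => hh ⟨ν, h0, rfl⟩
  have hmax : ∀ r : MvPowerSeries (Fin n) k, (∃ i ∈ supp s, a i ∣ r) →
      r ∈ IsLocalRing.maximalIdeal (MvPowerSeries (Fin n) k) := by
    rintro r ⟨i, -, hir⟩
    exact Ideal.mem_of_dvd _ hir (ha i)
  have hα : μ * alpha a s ∈ IsLocalRing.maximalIdeal (MvPowerSeries (Fin n) k) := by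
    obtain ⟨i, hi⟩ := supp_nonempty hs
    exact hmax _ ⟨i, hi, (Finset.dvd_prod_of_mem a hi).mul_left μ⟩
  have hc : (μ * alpha a s) ^ (p - 1) ∈ IsLocalRing.maximalIdeal (MvPowerSeries (Fin n) k) :=
    Ideal.pow_mem_of_mem _ hα _ (Nat.sub_pos_of_lt (Fact.out : p.Prime).one_lt)
  have hr : ∑ i ∈ supp s, ((s i).cast : MvPowerSeries (Fin n) k) * alphaDiv a s i ^ p *
      MvPowerSeries.X i ∈ IsLocalRing.maximalIdeal (MvPowerSeries (Fin n) k) := by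
    refine Ideal.sum_mem _ fun i _ => Ideal.mul_mem_left _ _ ?_
    rw [MvPowerSeries.maximalIdeal_eq_span_range_X]
    exact Ideal.subset_span ⟨i, rfl⟩
  have hloc : IsLocalRing (AdjoinRoot (f a μ s)) := by
    rw [f_eq]
    exact AdjoinRoot.isLocalRing_of_mem_maximalIdeal (Fact.out : p.Prime).one_lt hc hr
  have hres : ∃ θ : AdjoinRoot (f a μ s) →+* IsLocalRing.ResidueField (MvPowerSeries (Fin n) k),
      ∀ x, θ (AdjoinRoot.of _ x) = IsLocalRing.residue _ x := by
    rw [f_eq]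
    obtain ⟨θ, hθ, -⟩ := AdjoinRoot.exists_residue
      (c := (μ * alpha a s) ^ (p - 1)) (Fact.out : p.Prime).ne_zero hr
    exact ⟨θ, hθ⟩
  have hinjA : Function.Injective (algebraMap (MvPowerSeries (Fin n) k) (Tower p a μ)) :=
    algebraMap_tower_injective K L
  have hfin : Finite (L ≃ₐ[K] L) := Finite.of_equiv _ Φ.toEquiv
  -- The same generator `μ α` serves every nontrivial class: `σ z_s - z_s` is `μ α` times the
  -- nonzero constant `∑ ν_i s_i` of `𝔽_p`.
  refine ⟨?_, ?_, ?_, algebraMap _ B (μ * alpha a s), ?_, ?_, ?_⟩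
  · have : IsNoetherianRing (AdjoinRoot (f a μ s)) :=
      isNoetherianRing_of_surjective _ _ (AdjoinRoot.mk (f a μ s)) AdjoinRoot.mk_surjective
    exact isNoetherianRing_of_ringEquiv _ e.toRingEquiv
  · exact e.toRingEquiv.isLocalRing
  · have h1 : IsOfFinOrder (QuotientGroup.mk (Φ ν) : (L ≃ₐ[K] L) ⧸ Hs) := isOfFinOrder_of_finite _
    let toR : (B ≃ₐ[MvPowerSeries (Fin n) k] B) →* (B ≃+* B) :=
      MonoidHom.mk' (fun x => x.toRingEquiv) fun _ _ => rfl
    exact (toR.comp ρ).isOfFinOrder h1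
  · refine mem_nonZeroDivisors_of_ne_zero fun h0 => ?_
    have h1 : algebraMap (MvPowerSeries (Fin n) k) (Tower p a μ) (μ * alpha a s) = 0 :=
      congrArg Subtype.val h0
    exact mul_ne_zero hμ (alpha_ne_zero ha0 s) ((map_eq_zero_iff _ hinjA).1 h1)
  · intro hu
    -- The residue map of `R` extends to `R[z]/(f)` and kills `μ α`, which is therefore not a unit.
    obtain ⟨θ, hθ⟩ := hres
    have h1 := (hu.map e.symm).map θ
    rw [e.symm.commutes, AdjoinRoot.algebraMap_eq, hθ, (IsLocalRing.residue_eq_zero_iff _).2 hα] at h1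
    exact not_isUnit_zero h1
  · have hzB : z a μ s ∈ B := (hmem _).2 ⟨Polynomial.X, Polynomial.aeval_X _⟩
    refine fixedIdeal_eq_span_singleton (y := ⟨z a μ s, hzB⟩)
      (v := algebraMap _ B ((∑ i, ν.toAdd i * s i : ZMod p).cast : MvPowerSeries (Fin n) k)) ?_ ?_ ?_
    · have h1 : IsUnit (ZMod.castHom (dvd_refl p) (MvPowerSeries (Fin n) k) (∑ i, ν.toAdd i * s i)) :=
        (isUnit_iff_ne_zero.2 hν).map _
      exact h1.map _
    · refine Subtype.ext (hinjL ?_)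
      rw [hρ, ← map_mul]
      exact hΦ'.apply_z s ν.toAdd
    · rintro ⟨b, hb⟩
      obtain ⟨g, rfl⟩ := (hmem b).1 hb
      exact ⟨g, Subtype.ext (by rw [Polynomial.coe_aeval_mk_apply])⟩
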